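/- **Theorem 3.1 (Compactness of Flows).** Let $M$ be a smooth Hilbert manifold (a manifold modelled on a real Hilbert space, of finite or infinite dimension) with a smooth Riemannian metric whose distance is complete. Let $f : M \to \mathbb{R}$ be a Morse function, i.e. $f$ is smooth and at every critical point the Hessian is an isomorphism from the tangent space onto its dual. Suppose that $(M,f)$ is a CF pair, that is: 1. (Condition (C)) if $S \subseteq M$ is a subset on which $f$ is bounded but on which $\|\nabla f\|$ is not bounded away from $0$, then there is a critical point of $f$ in the closure of $S$; 2. every critical point has finite index, the index being the supremum of the dimensions of the subspaces on which the Hessian is negative definite. A flow line is an integral curve $\gamma : \mathbb{R} \to M$ of $-\nabla f$, and $\gamma(\pm\infty)$ denotes $\lim_{t \to \pm\infty} \gamma(t)$. Let $p$ and $q$ be two distinct critical points of $f$ and let $\{\gamma_n\}_{n=1}^{\infty}$ be flow lines with $\gamma_n(-\infty) = p$ and $\gamma_n(+\infty) = q$ for all $n$. Then there exist an integer $l \ge 0$, pairwise distinct critical points $r_0, \dots, r_{l+1}$ with $r_0 = p$ and $r_{l+1} = q$, and flow lines $\hat\gamma_0, \dots, \hat\gamma_l$ such that $\hat\gamma_i(-\infty)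 = r_i$ and $\hat\gamma_i(+\infty) = r_{i+1}$ for $i = 0, \dots, l$. Moreover, there exist a subsequence $\{\gamma_{n_k}\}_{k=1}^\infty$ of $\{\gamma_n\}$ and, for each $k$, times $s_{n_k}^0 < \dots < s_{n_k}^l$ such that $$\lim_{k \to \infty} \gamma_{n_k}(s_{n_k}^i) = \hat\gamma_i(0) \qquad (i = 0, \dots, l).$$ -/

import Mathlib

open Set Filter Topology Manifold Bundle
open scoped ContDiff

noncomputable section

namespace HilbertMorse

variable {E : Type*} [NormedAddCommGroup E] [InnerProductSpace ℝ E]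
  {M : Type*} [TopologicalSpace M] [ChartedSpace E M]

section Gradient

variable [RiemannianBundle (fun x : M ↦ TangentSpace 𝓘(ℝ, E) x)]

/-- The tangent spaces of a manifold modelled on a Hilbert space are complete for the norm of the
Riemannian metric, since this norm induces the topology of the model space. -/
instance completeSpace_tangentSpace [CompleteSpace E] (x : M) :
    CompleteSpace (TangentSpace 𝓘(ℝ, E) x) := by
  let e : E ≃L[ℝ] TangentSpace 𝓘(ℝ, E) x := ContinuousLinearEquiv.refl ℝ E
  exact (completeSpace_congr (e := e.toEquiv) e.isUniformEmbedding).1 inferInstance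

variable [CompleteSpace E]

/-- The Riemannian gradient `∇f`: the vector of `T_x M` that represents the differential of `f` at
`x` with respect to the Riemannian metric. -/
def grad (f : M → ℝ) (x : M) : TangentSpace 𝓘(ℝ, E) x :=
  (InnerProductSpace.toDual ℝ (TangentSpace 𝓘(ℝ, E) x)).symm (mfderiv 𝓘(ℝ, E) 𝓘(ℝ, ℝ) f x)

/-- A flow line of `-∇f`, defined for all times. -/
def IsFlowLine (f : M → ℝ) (γ : ℝ → M) : Prop :=
  IsMIntegralCurve (I := 𝓘(ℝ, E)) γ (fun x ↦ -grad (E := E) f x)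

end Gradient

variable (E)

/-- `p` is a critical point of `f`. -/
def IsCritical (f : M → ℝ) (p : M) : Prop :=
  mfderiv 𝓘(ℝ, E) 𝓘(ℝ, ℝ) f p = 0

/-- The Hessian of `f` at a critical point `p`: the second derivative of `f` read in the preferred
chart at `p`, which is the chart by which `T_p M` is identified with `E`. -/
def hessian (f : M → ℝ) (p : M) : E →L[ℝ] E →L[ℝ] ℝ :=
  fderiv ℝ (fderiv ℝ (f ∘ (extChartAt 𝓘(ℝ, E) p).symm)) (extChartAt 𝓘(ℝ, E) p p)

/-- A Morse function: a smooth function all of whose critical points are nondegenerate, i.e. the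
Hessian is an isomorphism from the tangent space onto its dual. -/
structure IsMorse (f : M → ℝ) : Prop where
  smooth : ContMDiff 𝓘(ℝ, E) 𝓘(ℝ, ℝ) ∞ f
  nondegenerate : ∀ p : M, IsCritical E f p → Function.Bijective (hessian E f p)

/-- The index of a critical point: the supremum of the dimensions of the subspaces on which the
Hessian is negative definite. -/
def index (f : M → ℝ) (p : M) : ℕ∞ :=
  ⨆ W : {W : Submodule ℝ E // ∀ v ∈ W, v ≠ 0 → hessian E f p v v < 0},
    Cardinal.toENat (Module.rank ℝ W.1)

variable [RiemannianBundle (fun x : M ↦ TangentSpace 𝓘(ℝ, E) x)] [CompleteSpace E]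

/-- Condition (C) of Palais and Smale: if `f` is bounded on `S` and `‖∇f‖` is not bounded away
from `0` on `S`, then the closure of `S` contains a critical point. -/
def ConditionC (f : M → ℝ) : Prop :=
  ∀ S : Set M, (∃ C : ℝ, ∀ x ∈ S, |f x| ≤ C) →
    (¬ ∃ c : ℝ, 0 < c ∧ ∀ x ∈ S, c ≤ ‖grad (E := E) f x‖) →
    ∃ p ∈ closure S, IsCritical E f p

/-- `(M, f)` is a CF pair: `f` is a Morse function that satisfies Condition (C) and all of whose
critical points have finite index. -/
structure IsCFPair (f : M → ℝ) : Prop where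
  morse : IsMorse E f
  conditionC : ConditionC E f
  finite_index : ∀ p : M, IsCritical E f p → index E f p < ⊤

end HilbertMorse

end

/-!
The compactness of flow lines between two critical points rests on three facts.

*Near a critical point* `r`, read in a chart, the linearization of `-∇f` is `L = -g⁻¹ H`, where `g` is
the metric and `H` the Hessian, so that `H u (L u) = -g (L u) (L u)` is negative definite. Hence `H`
decreases strictly along the difference of any two flow lines near `r`
(`exists_isAdapted`, `form_diff_orbits_le`). Flow lines that have stayed near `r` for a very long
time are therefore at positions whose differences are almost nonpositive for `H`; since `H` is
coercive up to a form of finite rank, because `r` is nondegenerate and of finite index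
(`exists_finite_rank_coercive`), these positions have a convergent subsequence
(`IsAdapted.exists_tendsto_subseq`). This replaces the stable and unstable manifolds. The same
neighbourhood bounds the change of the squared distance to `r` by the drop of `f`, which shows that
flow lines staying near `r`, or returning to it, converge to `r` (`IsAdapted.tendsto_atBot`,
`IsAdapted.tendsto_atTop`).

*Away from the critical points*, the length of a flow line is controlled by time and by the drop
of `f`, so that by completeness flow lines with bounded values of `f` that converge at one time
converge at all times to a flow line (`IsFlowLine.edist_le`, `exists_limit_flowLine`).

*Globally*, Condition (C) gives the Palais–Smale condition for sequences
(`IsCFPair.exists_tendsto_subseq`), whence the finiteness of the set of critical points with values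
in a bounded interval and the existence of a forward limit for each flow line on which `f` is
bounded.

If points of the given flow lines tend to a critical point `r ≠ q`, then the times spent near `r` tend
to infinity, so the exit points from a neighbourhood of `r` subconverge to a point of a flow line that
comes from `r` and goes to a critical point `r'` with `f r' < f r`; by a diagonal choice, later points
of the given flow lines tend to `r'` (`IsCFPair.exists_next`). Starting at `p`, this can be repeated
until `q` is reached, since there are only finitely many critical points between the levels of `q`
and `p` (`IsCFPair.exists_chain`). The values of `f` strictly decrease along the chain, so its
critical points are pairwise distinct.
-/

noncomputable section

namespace HilbertMorse

/-! ### The gradient in a chart -/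

section Chart

variable {E : Type*} [NormedAddCommGroup E] [InnerProductSpace ℝ E] [CompleteSpace E]
  {M : Type*} [TopologicalSpace M] [ChartedSpace E M]
  [RiemannianBundle (fun x : M ↦ TangentSpace 𝓘(ℝ, E) x)]

/-- The differential of `f` at `x`, with values in `ℝ`. -/
def differential (f : M → ℝ) (x : M) : TangentSpace 𝓘(ℝ, E) x →L[ℝ] ℝ :=
  mfderiv 𝓘(ℝ, E) 𝓘(ℝ, ℝ) f x

/-- The gradient represents the differential. -/
lemma inner_grad (f : M → ℝ) (x : M) (v : TangentSpace 𝓘(ℝ, E) x) :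
    inner ℝ (grad (E := E) f x) v = differential f x v := by
  unfold grad
  exact InnerProductSpace.toDual_symm_apply

lemma norm_grad_sq (f : M → ℝ) (x : M) :
    ‖grad (E := E) f x‖ ^ 2 = differential f x (grad (E := E) f x) := by
  rw [← inner_grad]
  exact (real_inner_self_eq_norm_sq (grad (E := E) f x)).symm

lemma grad_eq_zero_iff (f : M → ℝ) (x : M) :
    grad (E := E) f x = 0 ↔ IsCritical E f x := by
  unfold grad IsCritical
  exact (InnerProductSpace.toDual ℝ (TangentSpace 𝓘(ℝ, E) x)).symm.map_eq_zero_iff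

/-- The differential at `x` of the preferred chart at `x₀`, with values in the model space. -/
def chartDeriv (x₀ x : M) : TangentSpace 𝓘(ℝ, E) x →L[ℝ] E :=
  mfderiv 𝓘(ℝ, E) 𝓘(ℝ, E) (extChartAt 𝓘(ℝ, E) x₀) x

/-- The vector field `-∇f` read in the preferred chart at `x₀`. -/
def chartField (f : M → ℝ) (x₀ : M) (y : E) : E :=
  chartDeriv x₀ ((extChartAt 𝓘(ℝ, E) x₀).symm y)
    (-grad (E := E) f ((extChartAt 𝓘(ℝ, E) x₀).symm y))

lemma chartField_extChartAt (f : M → ℝ) {x₀ x : M} (hx : x ∈ (extChartAt 𝓘(ℝ, E) x₀).source) :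
    chartField f x₀ (extChartAt 𝓘(ℝ, E) x₀ x) = chartDeriv x₀ x (-grad (E := E) f x) := by
  unfold chartField
  rw [(extChartAt 𝓘(ℝ, E) x₀).left_inv hx]

variable [IsManifold 𝓘(ℝ, E) ∞ M]

omit [RiemannianBundle (fun x : M ↦ TangentSpace 𝓘(ℝ, E) x)] [CompleteSpace E] in
lemma exists_chartDeriv_eq {x₀ x : M} (hx : x ∈ (extChartAt 𝓘(ℝ, E) x₀).source) :
    ∃ e : TangentSpace 𝓘(ℝ, E) x ≃L[ℝ] E, (e : TangentSpace 𝓘(ℝ, E) x →L[ℝ] E) = chartDeriv x₀ x :=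
  isInvertible_mfderiv_extChartAt hx

omit [RiemannianBundle (fun x : M ↦ TangentSpace 𝓘(ℝ, E) x)] [CompleteSpace E] in
lemma contDiffAt_comp_extChartAt_symm {f : M → ℝ} (hf : ContMDiff 𝓘(ℝ, E) 𝓘(ℝ, ℝ) ∞ f) (x₀ : M)
    {y : E} (hy : y ∈ (extChartAt 𝓘(ℝ, E) x₀).target) :
    ContDiffAt ℝ ∞ (f ∘ (extChartAt 𝓘(ℝ, E) x₀).symm) y :=
  (hf.contMDiffAt.comp _ ((contMDiffOn_extChartAt_symm x₀).contMDiffAt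
      ((isOpen_extChartAt_target x₀).mem_nhds hy))).contDiffAt

omit [RiemannianBundle (fun x : M ↦ TangentSpace 𝓘(ℝ, E) x)] [CompleteSpace E] in
lemma fderiv_comp_extChartAt_symm {f : M → ℝ} (hf : ContMDiff 𝓘(ℝ, E) 𝓘(ℝ, ℝ) ∞ f) (x₀ : M)
    {x : M} (hx : x ∈ (extChartAt 𝓘(ℝ, E) x₀).source) (v : TangentSpace 𝓘(ℝ, E) x) :
    fderiv ℝ (f ∘ (extChartAt 𝓘(ℝ, E) x₀).symm) (extChartAt 𝓘(ℝ, E) x₀ x) (chartDeriv x₀ x v) =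
    differential f x v := by
  have hx' : x ∈ (chartAt E x₀).source := by simpa using hx
  have h1 := (contDiffAt_comp_extChartAt_symm hf x₀
    ((extChartAt 𝓘(ℝ, E) x₀).map_source hx)).contMDiffAt
  have h2 := (h1.mdifferentiableAt (by simp)).hasMFDerivAt.comp x
    (mdifferentiableAt_extChartAt (I := 𝓘(ℝ, E)) hx').hasMFDerivAt
  have h3 : HasMFDerivAt 𝓘(ℝ, E) 𝓘(ℝ, ℝ) f x (mfderiv 𝓘(ℝ, E) 𝓘(ℝ, ℝ) f x) :=
    (hf.contMDiffAt.mdifferentiableAt (by simp)).hasMFDerivAt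
  have h4 : f =ᶠ[𝓝 x] (f ∘ (extChartAt 𝓘(ℝ, E) x₀).symm) ∘ (extChartAt 𝓘(ℝ, E) x₀) := by
    filter_upwards [extChartAt_source_mem_nhds' (I := 𝓘(ℝ, E)) hx] with z hz
    exact congrArg f ((extChartAt 𝓘(ℝ, E) x₀).left_inv hz).symm
  have h5 := h2.congr_of_eventuallyEq h4
  unfold differential
  rw [hasMFDerivAt_unique h3 h5, mfderiv_eq_fderiv]
  rfl

omit [CompleteSpace E] in
/-- The Riemannian metric read in the preferred chart at `x₀` is a smooth field of bilinear forms
on the model space. -/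
lemma exists_chart_metric
    [IsContMDiffRiemannianBundle 𝓘(ℝ, E) ∞ E (fun x : M ↦ TangentSpace 𝓘(ℝ, E) x)] (x₀ : M) :
    ∃ G : E → E →L[ℝ] E →L[ℝ] ℝ,
      ContDiffAt ℝ 1 G (extChartAt 𝓘(ℝ, E) x₀ x₀) ∧
      ∀ x ∈ (extChartAt 𝓘(ℝ, E) x₀).source, ∀ v w : TangentSpace 𝓘(ℝ, E) x,
        G (extChartAt 𝓘(ℝ, E) x₀ x) (chartDeriv x₀ x v) (chartDeriv x₀ x w) = inner ℝ v w := by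
  obtain ⟨g, hg, hgi⟩ := IsContMDiffRiemannianBundle.exists_contMDiff (IB := 𝓘(ℝ, E)) (n := ∞)
    (F := E) (E := fun x : M ↦ TangentSpace 𝓘(ℝ, E) x)
  have h1 := (contMDiffAt_hom_bundle _).1 (hg x₀) |>.2
  have h2 : ContMDiffAt 𝓘(ℝ, E) 𝓘(ℝ, E) ∞ (extChartAt 𝓘(ℝ, E) x₀).symm
      (extChartAt 𝓘(ℝ, E) x₀ x₀) :=
    (contMDiffOn_extChartAt_symm x₀).contMDiffAt (extChartAt_target_mem_nhds x₀)
  have h3 := ContMDiffAt.comp_of_eq (x := extChartAt 𝓘(ℝ, E) x₀ x₀) h1 h2 (by simp)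
  refine ⟨_, (h3.contDiffAt).of_le (by simp), fun x hx v w ↦ ?_⟩
  have hx' : x ∈ (chartAt E x₀).source := by simpa using hx
  simp only [Function.comp_apply]
  have key : ∀ v : TangentSpace 𝓘(ℝ, E) x,
      (trivializationAt E (TangentSpace 𝓘(ℝ, E)) x₀).symm x (chartDeriv x₀ x v) = v := by
    intro v
    unfold chartDeriv
    rw [← TangentBundle.continuousLinearMapAt_trivializationAt hx']
    have hb : x ∈ (trivializationAt E (TangentSpace 𝓘(ℝ, E)) x₀).baseSet := by simpa using hx'
    rw [← Trivialization.symmL_apply (R := ℝ) _ hb]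
    exact (trivializationAt E (TangentSpace 𝓘(ℝ, E)) x₀).symmL_continuousLinearMapAt (R := ℝ) hb v
  rw [(extChartAt 𝓘(ℝ, E) x₀).left_inv hx]
  rw [inCoordinates_apply_eq₂ (by simpa using hx') (by simpa using hx') (Set.mem_univ _)]
  rw [key, key, ← hgi]
  simp

end Chart

/-! ### Regularity of the gradient field -/

section GradientField

variable {E : Type*} [NormedAddCommGroup E] [InnerProductSpace ℝ E] [CompleteSpace E]
  {M : Type*} [TopologicalSpace M] [ChartedSpace E M]
  [RiemannianBundle (fun x : M ↦ TangentSpace 𝓘(ℝ, E) x)]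
  [IsManifold 𝓘(ℝ, E) ∞ M]

lemma one_add_one_le_infty : (1 + 1 : WithTop ℕ∞) ≤ ∞ := by
  rw [one_add_one_eq_two]
  exact WithTop.coe_le_coe.2 (le_top : (2 : ℕ∞) ≤ ⊤)

omit [IsManifold 𝓘(ℝ, E) ∞ M] in
/-- A field of bilinear forms that represents the metric in a chart identifies the chart
expression of the gradient with the differential of the chart expression of `f`. -/
lemma chart_metric_chartField [IsManifold 𝓘(ℝ, E) ∞ M] {f : M → ℝ}
    (hf : ContMDiff 𝓘(ℝ, E) 𝓘(ℝ, ℝ) ∞ f) {x₀ : M}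
    {G : E → E →L[ℝ] E →L[ℝ] ℝ}
    (hG : ∀ x ∈ (extChartAt 𝓘(ℝ, E) x₀).source, ∀ v w : TangentSpace 𝓘(ℝ, E) x,
      G (extChartAt 𝓘(ℝ, E) x₀ x) (chartDeriv x₀ x v) (chartDeriv x₀ x w) = inner ℝ v w)
    {y : E} (hy : y ∈ (extChartAt 𝓘(ℝ, E) x₀).target) :
    G y (chartField f x₀ y) = -fderiv ℝ (f ∘ (extChartAt 𝓘(ℝ, E) x₀).symm) y := by
  have hx := (extChartAt 𝓘(ℝ, E) x₀).map_target hy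
  obtain ⟨e, he⟩ := exists_chartDeriv_eq hx
  refine ContinuousLinearMap.ext fun w ↦ ?_
  obtain ⟨v, rfl⟩ : ∃ v, chartDeriv x₀ ((extChartAt 𝓘(ℝ, E) x₀).symm y) v = w :=
    ⟨e.symm w, by rw [← he]; exact e.apply_symm_apply w⟩
  have h1 := hG _ hx (-grad (E := E) f ((extChartAt 𝓘(ℝ, E) x₀).symm y)) v
  have h2 := fderiv_comp_extChartAt_symm hf x₀ hx v
  rw [(extChartAt 𝓘(ℝ, E) x₀).right_inv hy] at h1 h2
  change _ = -(fderiv ℝ (f ∘ (extChartAt 𝓘(ℝ, E) x₀).symm) y _)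
  rw [h2, ← inner_grad]
  refine h1.trans (inner_neg_left _ _)

lemma chart_metric_isInvertible {x₀ : M} {G : E → E →L[ℝ] E →L[ℝ] ℝ}
    (hG : ∀ x ∈ (extChartAt 𝓘(ℝ, E) x₀).source, ∀ v w : TangentSpace 𝓘(ℝ, E) x,
      G (extChartAt 𝓘(ℝ, E) x₀ x) (chartDeriv x₀ x v) (chartDeriv x₀ x w) = inner ℝ v w)
    {x : M} (hx : x ∈ (extChartAt 𝓘(ℝ, E) x₀).source) :
    (G (extChartAt 𝓘(ℝ, E) x₀ x)).IsInvertible := by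
  obtain ⟨e, he⟩ := exists_chartDeriv_eq hx
  have hG' : ∀ a b : E, G (extChartAt 𝓘(ℝ, E) x₀ x) a b = inner ℝ (e.symm a) (e.symm b) := by
    intro a b
    rw [← hG x hx, ← he]
    simp
  have hb : Function.Bijective (G (extChartAt 𝓘(ℝ, E) x₀ x)) := by
    constructor
    · refine (injective_iff_map_eq_zero _).2 fun a ha ↦ ?_
      have h := hG' a a
      rw [ha] at h
      have h' : inner ℝ (e.symm a) (e.symm a) = 0 := h.symm
      rw [inner_self_eq_zero] at h'
      simpa using h'
    · intro l
      refine ⟨e ((InnerProductSpace.toDual ℝ (TangentSpace 𝓘(ℝ, E) x)).symm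
        (l.comp (e : TangentSpace 𝓘(ℝ, E) x →L[ℝ] E))), ?_⟩
      ext b
      rw [hG', e.symm_apply_apply]
      refine InnerProductSpace.toDual_symm_apply.trans ?_
      simp
  exact ⟨ContinuousLinearEquiv.ofBijective _ (LinearMap.ker_eq_bot.2 hb.1)
    (LinearMap.range_eq_top.2 hb.2), ContinuousLinearEquiv.coe_ofBijective _ _ _⟩

omit [CompleteSpace E] in
lemma chart_metric_coercive {x₀ : M} {G : E → E →L[ℝ] E →L[ℝ] ℝ}
    (hG : ∀ x ∈ (extChartAt 𝓘(ℝ, E) x₀).source, ∀ v w : TangentSpace 𝓘(ℝ, E) x,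
      G (extChartAt 𝓘(ℝ, E) x₀ x) (chartDeriv x₀ x v) (chartDeriv x₀ x w) = inner ℝ v w)
    {x : M} (hx : x ∈ (extChartAt 𝓘(ℝ, E) x₀).source) :
    ∃ c > 0, ∀ a : E, c * ‖a‖ ^ 2 ≤ G (extChartAt 𝓘(ℝ, E) x₀ x) a a := by
  obtain ⟨e, he⟩ := exists_chartDeriv_eq hx
  have hG' : ∀ a : E, G (extChartAt 𝓘(ℝ, E) x₀ x) a a = ‖e.symm a‖ ^ 2 := by
    intro a
    refine Eq.trans ?_ (real_inner_self_eq_norm_sq (e.symm a))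
    rw [← hG x hx, ← he]
    simp
  set C : ℝ := ‖(e : TangentSpace 𝓘(ℝ, E) x →L[ℝ] E)‖ + 1 with hC
  have hC0 : 0 < C := by positivity
  refine ⟨(C ^ 2)⁻¹, by positivity, fun a ↦ ?_⟩
  rw [hG', inv_mul_le_iff₀ (by positivity), ← mul_pow]
  gcongr
  have := (e : TangentSpace 𝓘(ℝ, E) x →L[ℝ] E).le_opNorm (e.symm a)
  simp only [ContinuousLinearEquiv.coe_coe, ContinuousLinearEquiv.apply_symm_apply] at this
  refine this.trans ?_
  gcongr
  rw [hC]
  linarith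

variable [IsContMDiffRiemannianBundle 𝓘(ℝ, E) ∞ E (fun x : M ↦ TangentSpace 𝓘(ℝ, E) x)]
  {f : M → ℝ}

/-- In a chart, `-∇f` is obtained from the differential of `f` by inverting the metric. -/
lemma contDiffAt_chartField (hf : ContMDiff 𝓘(ℝ, E) 𝓘(ℝ, ℝ) ∞ f) (x₀ : M) :
    ContDiffAt ℝ 1 (chartField (E := E) f x₀) (extChartAt 𝓘(ℝ, E) x₀ x₀) := by
  obtain ⟨G, hG1, hG⟩ := exists_chart_metric (E := E) x₀
  have h1 : ContDiffAt ℝ 1 (fderiv ℝ (f ∘ (extChartAt 𝓘(ℝ, E) x₀).symm))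
      (extChartAt 𝓘(ℝ, E) x₀ x₀) :=
    (contDiffAt_comp_extChartAt_symm hf x₀ (mem_extChartAt_target x₀)).fderiv_right
      (m := 1) one_add_one_le_infty
  have h2 : ContDiffAt ℝ 1 (fun y ↦ (G y).inverse) (extChartAt 𝓘(ℝ, E) x₀ x₀) :=
    ContDiffAt.comp _ (chart_metric_isInvertible hG
      (mem_extChartAt_source x₀)).contDiffAt_map_inverse hG1
  refine ((h2.clm_apply h1).neg).congr_of_eventuallyEq ?_
  filter_upwards [extChartAt_target_mem_nhds (I := 𝓘(ℝ, E)) x₀] with y hy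
  have h3 := chart_metric_chartField hf hG hy
  have h4 : (G y).IsInvertible := by
    have := chart_metric_isInvertible hG ((extChartAt 𝓘(ℝ, E) x₀).map_target hy)
    rwa [(extChartAt 𝓘(ℝ, E) x₀).right_inv hy] at this
  obtain ⟨e, he⟩ := h4
  rw [← he] at h3
  simp only [← he, ContinuousLinearMap.inverse_equiv]
  rw [← neg_eq_iff_eq_neg] at h3
  rw [← h3]
  simp

/-- The vector field `-∇f` is of class `C¹`. -/
lemma contMDiff_neg_grad (hf : ContMDiff 𝓘(ℝ, E) 𝓘(ℝ, ℝ) ∞ f) :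
    ContMDiff 𝓘(ℝ, E) 𝓘(ℝ, E).tangent 1
      (fun x ↦ (⟨x, -grad (E := E) f x⟩ : TangentBundle 𝓘(ℝ, E) M)) := by
  intro x₀
  rw [contMDiffAt_section]
  have h1 : ContMDiffAt 𝓘(ℝ, E) 𝓘(ℝ, E) 1 (chartField (E := E) f x₀ ∘ extChartAt 𝓘(ℝ, E) x₀) x₀ :=
    (contDiffAt_chartField hf x₀).contMDiffAt.comp x₀ contMDiffAt_extChartAt
  refine h1.congr_of_eventuallyEq ?_
  filter_upwards [extChartAt_source_mem_nhds (I := 𝓘(ℝ, E)) x₀] with x hx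
  have hx' : x ∈ (chartAt E x₀).source := by simpa using hx
  rw [Function.comp_apply, chartField_extChartAt f hx]
  unfold chartDeriv
  rw [← TangentBundle.continuousLinearMapAt_trivializationAt hx']
  rw [Trivialization.continuousLinearMapAt_apply,
    Trivialization.coe_linearMapAt_of_mem _ (by simpa using hx')]

omit [IsContMDiffRiemannianBundle 𝓘(ℝ, E) ∞ E (fun x : M ↦ TangentSpace 𝓘(ℝ, E) x)] in
lemma norm_grad_sq_eq_chart (hf : ContMDiff 𝓘(ℝ, E) 𝓘(ℝ, ℝ) ∞ f) {x₀ x : M}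
    (hx : x ∈ (extChartAt 𝓘(ℝ, E) x₀).source) :
    ‖grad (E := E) f x‖ ^ 2 = -fderiv ℝ (f ∘ (extChartAt 𝓘(ℝ, E) x₀).symm)
      (extChartAt 𝓘(ℝ, E) x₀ x) (chartField (E := E) f x₀ (extChartAt 𝓘(ℝ, E) x₀ x)) := by
  rw [chartField_extChartAt f hx, fderiv_comp_extChartAt_symm hf x₀ hx, norm_grad_sq, map_neg,
    neg_neg]

lemma continuous_norm_grad (hf : ContMDiff 𝓘(ℝ, E) 𝓘(ℝ, ℝ) ∞ f) :
    Continuous fun x ↦ ‖grad (E := E) f x‖ := by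
  have h : Continuous fun x ↦ ‖grad (E := E) f x‖ ^ 2 := by
    refine continuous_iff_continuousAt.2 fun x₀ ↦ ?_
    have h1 : ContinuousAt (fderiv ℝ (f ∘ (extChartAt 𝓘(ℝ, E) x₀).symm))
        (extChartAt 𝓘(ℝ, E) x₀ x₀) :=
      ((contDiffAt_comp_extChartAt_symm hf x₀ (mem_extChartAt_target x₀)).fderiv_right
        (m := 1) one_add_one_le_infty).continuousAt
    have h2 := ((h1.clm_apply (contDiffAt_chartField hf x₀).continuousAt).neg).comp
      (continuousAt_extChartAt (I := 𝓘(ℝ, E)) x₀)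
    refine h2.congr ?_
    filter_upwards [extChartAt_source_mem_nhds (I := 𝓘(ℝ, E)) x₀] with x hx
    exact (norm_grad_sq_eq_chart hf hx).symm
  have h' := h.sqrt
  simpa using h'

/-! ### Flow lines -/

section FlowLines

omit [IsContMDiffRiemannianBundle 𝓘(ℝ, E) ∞ E (fun x : M ↦ TangentSpace 𝓘(ℝ, E) x)]

omit [IsManifold 𝓘(ℝ, E) ∞ M] in
lemma IsFlowLine.comp_add {γ : ℝ → M} (hγ : IsFlowLine (E := E) f γ) (s : ℝ) :
    IsFlowLine (E := E) f (γ ∘ (· + s)) :=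
  IsMIntegralCurve.comp_add hγ s

omit [IsManifold 𝓘(ℝ, E) ∞ M] in
lemma IsFlowLine.continuous {γ : ℝ → M} (hγ : IsFlowLine (E := E) f γ) : Continuous γ :=
  IsMIntegralCurve.continuous hγ

omit [IsManifold 𝓘(ℝ, E) ∞ M] in
lemma IsFlowLine.hasDerivAt_comp [IsManifold 𝓘(ℝ, E) ∞ M] (hf : ContMDiff 𝓘(ℝ, E) 𝓘(ℝ, ℝ) ∞ f)
    {γ : ℝ → M} (hγ : IsFlowLine (E := E) f γ) (t : ℝ) :
    HasDerivAt (f ∘ γ) (-‖grad (E := E) f (γ t)‖ ^ 2) t := by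
  have h1 := (hf.contMDiffAt.mdifferentiableAt (by simp)).hasMFDerivAt (x := γ t)
  have h2 : HasFDerivAt (f ∘ γ) ((differential f (γ t)).comp
    ((1 : ℝ →L[ℝ] ℝ).smulRight (-grad (E := E) f (γ t)))) t := (h1.comp t (hγ t)).hasFDerivAt
  refine h2.hasDerivAt.congr_deriv ?_
  rw [norm_grad_sq, ← map_neg]
  change differential f (γ t) ((1 : ℝ) • (-grad (E := E) f (γ t))) = _
  rw [one_smul]

lemma IsFlowLine.hasDerivAt_chart {γ : ℝ → M} (hγ : IsFlowLine (E := E) f γ) {x₀ : M} {t : ℝ}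
    (ht : γ t ∈ (extChartAt 𝓘(ℝ, E) x₀).source) :
    HasDerivAt (extChartAt 𝓘(ℝ, E) x₀ ∘ γ)
      (chartField (E := E) f x₀ (extChartAt 𝓘(ℝ, E) x₀ (γ t))) t := by
  have hx' : γ t ∈ (chartAt E x₀).source := by simpa using ht
  have h1 := (mdifferentiableAt_extChartAt (I := 𝓘(ℝ, E)) hx').hasMFDerivAt
  have h2 : HasFDerivAt (extChartAt 𝓘(ℝ, E) x₀ ∘ γ) ((chartDeriv x₀ (γ t)).comp
    ((1 : ℝ →L[ℝ] ℝ).smulRight (-grad (E := E) f (γ t)))) t := (h1.comp t (hγ t)).hasFDerivAt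
  refine h2.hasDerivAt.congr_deriv ?_
  rw [chartField_extChartAt f ht]
  change chartDeriv x₀ (γ t) ((1 : ℝ) • (-grad (E := E) f (γ t))) = _
  rw [one_smul]

/-- A solution of the differential equation in a chart is an integral curve in the manifold. -/
lemma hasMFDerivAt_extChartAt_symm_comp {x₀ : M} {α : ℝ → E} {t : ℝ}
    (ht : α t ∈ (extChartAt 𝓘(ℝ, E) x₀).target)
    (hα : HasDerivAt α (chartField (E := E) f x₀ (α t)) t) :
    HasMFDerivAt 𝓘(ℝ, ℝ) 𝓘(ℝ, E) ((extChartAt 𝓘(ℝ, E) x₀).symm ∘ α) t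
      ((1 : ℝ →L[ℝ] ℝ).smulRight (-grad (E := E) f (((extChartAt 𝓘(ℝ, E) x₀).symm ∘ α) t))) := by
  have h1 : HasMFDerivAt 𝓘(ℝ, E) 𝓘(ℝ, E) (extChartAt 𝓘(ℝ, E) x₀).symm (α t)
      (mfderiv 𝓘(ℝ, E) 𝓘(ℝ, E) (extChartAt 𝓘(ℝ, E) x₀).symm (α t)) :=
    (((contMDiffOn_extChartAt_symm (n := ∞) x₀).contMDiffAt
      ((isOpen_extChartAt_target x₀).mem_nhds ht)).mdifferentiableAt (by simp)).hasMFDerivAt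
  have h2 : HasMFDerivAt 𝓘(ℝ, ℝ) 𝓘(ℝ, E) α t _ := hα.hasFDerivAt.hasMFDerivAt
  have h3 := h1.comp t h2
  refine h3.congr_mfderiv ?_
  refine ContinuousLinearMap.ext_ring ?_
  have h4 := mfderivWithin_extChartAt_symm_comp_mfderiv_extChartAt (I := 𝓘(ℝ, E)) ht
  have h5 := congrArg (fun L ↦ L (-grad (E := E) f ((extChartAt 𝓘(ℝ, E) x₀).symm (α t)))) h4
  simp only [modelWithCornersSelf_coe, range_id, mfderivWithin_univ] at h5
  simp only [Function.comp_apply]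
  change mfderiv 𝓘(ℝ, E) 𝓘(ℝ, E) (extChartAt 𝓘(ℝ, E) x₀).symm (α t)
      ((1 : ℝ) • chartField (E := E) f x₀ (α t)) =
    (1 : ℝ) • (-grad (E := E) f ((extChartAt 𝓘(ℝ, E) x₀).symm (α t)))
  rw [one_smul, one_smul]
  exact h5

end FlowLines

end GradientField

/-! ### Limits of flow lines -/

section LocalFlow

variable {E : Type*} [NormedAddCommGroup E] [InnerProductSpace ℝ E] [CompleteSpace E]
  {M : Type*} [TopologicalSpace M] [ChartedSpace E M]
  [RiemannianBundle (fun x : M ↦ TangentSpace 𝓘(ℝ, E) x)]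
  [IsManifold 𝓘(ℝ, E) ∞ M]
  [IsContMDiffRiemannianBundle 𝓘(ℝ, E) ∞ E (fun x : M ↦ TangentSpace 𝓘(ℝ, E) x)]
  {f : M → ℝ}

/-- Local existence of integral curves together with continuous dependence on the initial point. -/
lemma exists_local_limit_flowLine [T2Space M] (hf : ContMDiff 𝓘(ℝ, E) 𝓘(ℝ, ℝ) ∞ f) (x : M) :
    ∃ ε > 0, ∃ Φ : ℝ → M,
      IsMIntegralCurveOn (I := 𝓘(ℝ, E)) Φ (fun x ↦ -grad (E := E) f x) (Ioo (-ε) ε) ∧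
      ∀ ξ : ℕ → ℝ → M, (∀ n, IsFlowLine (E := E) f (ξ n)) →
        Tendsto (fun n ↦ ξ n 0) atTop (𝓝 x) →
        ∀ t ∈ Ioo (-ε) ε, Tendsto (fun n ↦ ξ n t) atTop (𝓝 (Φ t)) := by
  set φ := extChartAt 𝓘(ℝ, E) x with hφ
  obtain ⟨ε₀, hε₀, a, r, L, K, hr, hpl⟩ :=
    IsPicardLindelof.of_contDiffAt_one (contDiffAt_chartField (E := E) hf x)
  obtain ⟨α, hα, hαc⟩ :=
    (hpl 0).exists_forall_mem_closedBall_eq_hasDerivWithinAt_continuousOn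
  simp only [zero_sub, zero_add] at hα hαc
  have hr' : (0 : ℝ) < r := hr
  have hcont : ∀ t ∈ Ioo (-ε₀) ε₀, ContinuousAt α (φ x, t) := fun t ht ↦
    hαc.continuousAt (prod_mem_nhds (Metric.closedBall_mem_nhds _ hr') (Icc_mem_nhds ht.1 ht.2))
  have h0 : (0 : ℝ) ∈ Ioo (-ε₀) ε₀ := ⟨by linarith, hε₀⟩
  have hα0 : α (φ x, 0) = φ x := (hα _ (Metric.mem_closedBall_self hr'.le)).1
  have hev : ∀ᶠ z in 𝓝 (φ x, (0 : ℝ)), α z ∈ φ.target := by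
    refine (hcont 0 h0).eventually_mem ?_
    rw [hα0]
    exact extChartAt_target_mem_nhds x
  rw [nhds_prod_eq] at hev
  obtain ⟨p, hp, q, hq, hpq⟩ := eventually_prod_iff.1 hev
  obtain ⟨δ, hδ, hδq⟩ := Metric.eventually_nhds_iff.1 hq
  set ε := min ε₀ δ with hε
  have hεpos : 0 < ε := lt_min hε₀ hδ
  have hεsub : ∀ t ∈ Ioo (-ε) ε, t ∈ Ioo (-ε₀) ε₀ ∧ q t := by
    intro t ht
    have h1 := min_le_left ε₀ δ
    have h2 := min_le_right ε₀ δ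
    refine ⟨⟨by linarith [ht.1], by linarith [ht.2]⟩, hδq ?_⟩
    rw [Real.dist_eq, sub_zero, abs_lt]
    exact ⟨by linarith [ht.1], by linarith [ht.2]⟩
  have hint : ∀ y ∈ Metric.closedBall (φ x) r, p y →
      IsMIntegralCurveOn (I := 𝓘(ℝ, E)) (φ.symm ∘ fun t ↦ α (y, t))
        (fun x ↦ -grad (E := E) f x) (Ioo (-ε) ε) := by
    intro y hy hpy t ht
    obtain ⟨ht1, ht2⟩ := hεsub t ht
    refine (hasMFDerivAt_extChartAt_symm_comp (hpq hpy ht2) ?_).hasMFDerivWithinAt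
    exact ((hα y hy).2 t (Ioo_subset_Icc_self ht1)).hasDerivAt (Icc_mem_nhds ht1.1 ht1.2)
  have hself : φ x ∈ Metric.closedBall (φ x) (r : ℝ) := Metric.mem_closedBall_self hr'.le
  refine ⟨ε, hεpos, φ.symm ∘ fun t ↦ α (φ x, t), hint _ hself hp.self_of_nhds, ?_⟩
  intro ξ hξ hx t ht
  obtain ⟨ht1, ht2⟩ := hεsub t ht
  have hφξ : Tendsto (fun n ↦ φ (ξ n 0)) atTop (𝓝 (φ x)) :=
    (continuousAt_extChartAt (I := 𝓘(ℝ, E)) x).tendsto.comp hx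
  have hlim : Tendsto (fun n ↦ φ.symm (α (φ (ξ n 0), t))) atTop (𝓝 (φ.symm (α (φ x, t)))) := by
    refine Tendsto.comp (continuousAt_extChartAt_symm'' (hpq hp.self_of_nhds ht2)) ?_
    exact (hcont t ht1).tendsto.comp (hφξ.prodMk_nhds tendsto_const_nhds)
  refine hlim.congr' ?_
  filter_upwards [hφξ.eventually hp, hφξ.eventually (Metric.closedBall_mem_nhds _ hr'),
    hx.eventually (extChartAt_source_mem_nhds (I := 𝓘(ℝ, E)) x)] with n hn1 hn2 hn3
  have h0' : (0 : ℝ) ∈ Ioo (-ε) ε := ⟨by linarith, hεpos⟩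
  refine isMIntegralCurveOn_Ioo_eqOn_of_contMDiff_boundaryless h0' (contMDiff_neg_grad hf)
    (hint _ hn2 hn1) ((hξ n).isMIntegralCurveOn _) ?_ ht
  rw [Function.comp_apply, (hα _ hn2).1]
  exact φ.left_inv hn3

lemma IsFlowLine.contMDiff (hf : ContMDiff 𝓘(ℝ, E) 𝓘(ℝ, ℝ) ∞ f) {γ : ℝ → M}
    (hγ : IsFlowLine (E := E) f γ) : ContMDiff 𝓘(ℝ, ℝ) 𝓘(ℝ, E) 1 γ := by
  intro t
  have hc : ContinuousAt γ t := hγ.continuous.continuousAt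
  rw [contMDiffAt_iff_target]
  refine ⟨hc, ContDiffAt.contMDiffAt ?_⟩
  have h1 : ∀ᶠ s in 𝓝 t, HasDerivAt (extChartAt 𝓘(ℝ, E) (γ t) ∘ γ)
      (chartField (E := E) f (γ t) (extChartAt 𝓘(ℝ, E) (γ t) (γ s))) s := by
    filter_upwards [hc.eventually (extChartAt_source_mem_nhds (I := 𝓘(ℝ, E)) (γ t))] with s hs
    exact hγ.hasDerivAt_chart hs
  have h2 : ∀ᶠ s in 𝓝 t, ContinuousAt
      (fun s ↦ chartField (E := E) f (γ t) (extChartAt 𝓘(ℝ, E) (γ t) (γ s))) s := by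
    have h3 := (contDiffAt_chartField (E := E) hf (γ t)).eventually (by simp)
    have h4 := (((continuousAt_extChartAt (I := 𝓘(ℝ, E)) (γ t)).comp hc).eventually h3)
    filter_upwards [h4, hc.eventually (extChartAt_source_mem_nhds (I := 𝓘(ℝ, E)) (γ t))]
      with s hs1 hs2
    have h5 : ContinuousAt (extChartAt 𝓘(ℝ, E) (γ t)) (γ s) := continuousAt_extChartAt' hs2
    exact ContinuousAt.comp (f := fun s ↦ extChartAt 𝓘(ℝ, E) (γ t) (γ s)) hs1.continuousAt
      (h5.comp hγ.continuous.continuousAt)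
  obtain ⟨u, hu, hu'⟩ := (h1.and h2).exists_mem
  rw [contDiffAt_one_iff]
  refine ⟨_, u, hu, ?_, fun s hs ↦ (hu' s hs).1.hasFDerivAt⟩
  intro s hs
  refine ContinuousAt.continuousWithinAt ?_
  exact ((ContinuousLinearMap.toSpanSingletonCLE (𝕜 := ℝ) (E := E)).continuous.continuousAt).comp
    (hu' s hs).2

end LocalFlow

section GlobalLimit

variable {E : Type*} [NormedAddCommGroup E] [InnerProductSpace ℝ E] [CompleteSpace E]
  {M : Type*} [EMetricSpace M] [ChartedSpace E M]
  [RiemannianBundle (fun x : M ↦ TangentSpace 𝓘(ℝ, E) x)]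
  [IsManifold 𝓘(ℝ, E) ∞ M]
  [IsContMDiffRiemannianBundle 𝓘(ℝ, E) ∞ E (fun x : M ↦ TangentSpace 𝓘(ℝ, E) x)]
  [IsRiemannianManifold 𝓘(ℝ, E) M]
  {f : M → ℝ}

/-- The length of a piece of a flow line is controlled by its duration and by the drop of `f`
along it, since `‖∇f‖ ≤ κ⁻¹ + κ ‖∇f‖²`. -/
lemma IsFlowLine.edist_le (hf : ContMDiff 𝓘(ℝ, E) 𝓘(ℝ, ℝ) ∞ f) {γ : ℝ → M}
    (hγ : IsFlowLine (E := E) f γ) {κ : ℝ} (hκ : 0 < κ) {a b : ℝ} (hab : a ≤ b) :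
    edist (γ a) (γ b) ≤ ENNReal.ofReal (κ⁻¹ * (b - a) + κ * (f (γ a) - f (γ b))) := by
  rw [IsRiemannianManifold.out (I := 𝓘(ℝ, E)) (γ a) (γ b)]
  refine (riemannianEDist_le_pathELength (hγ.contMDiff hf).contMDiffOn rfl rfl hab).trans ?_
  rw [pathELength_eq_lintegral_mfderiv_Icc]
  have hcont : Continuous fun t ↦ κ⁻¹ + κ * ‖grad (E := E) f (γ t)‖ ^ 2 :=
    continuous_const.add
      (continuous_const.mul (((continuous_norm_grad hf).comp hγ.continuous).pow 2))
  have hint : ∫ t in a..b, (κ⁻¹ + κ * ‖grad (E := E) f (γ t)‖ ^ 2) =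
      κ⁻¹ * (b - a) + κ * (f (γ a) - f (γ b)) := by
    have hd : ∀ t ∈ uIcc a b, HasDerivAt (fun t ↦ κ⁻¹ * t - κ * (f ∘ γ) t)
        (κ⁻¹ + κ * ‖grad (E := E) f (γ t)‖ ^ 2) t := by
      intro t _
      refine (((hasDerivAt_id t).const_mul κ⁻¹).sub
        ((hγ.hasDerivAt_comp hf t).const_mul κ)).congr_deriv ?_
      ring
    rw [intervalIntegral.integral_eq_sub_of_hasDerivAt hd (hcont.intervalIntegrable a b)]
    simp only [Function.comp_apply]
    ring
  rw [← hint, intervalIntegral.integral_of_le hab, ← MeasureTheory.integral_Icc_eq_integral_Ioc,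
    MeasureTheory.ofReal_integral_eq_lintegral_ofReal]
  · refine MeasureTheory.lintegral_mono fun t ↦ ?_
    have h1 : ‖(mfderiv 𝓘(ℝ, ℝ) 𝓘(ℝ, E) γ t) 1‖ₑ = ENNReal.ofReal ‖grad (E := E) f (γ t)‖ := by
      rw [(hγ t).mfderiv]
      change ‖(1 : ℝ) • (-grad (E := E) f (γ t))‖ₑ = _
      rw [one_smul]
      refine (enorm_neg _).trans (ofReal_norm _).symm
    rw [h1]
    refine ENNReal.ofReal_le_ofReal ?_
    have h2 : κ⁻¹ + κ * ‖grad (E := E) f (γ t)‖ ^ 2 - ‖grad (E := E) f (γ t)‖ =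
        κ⁻¹ * ((κ * ‖grad (E := E) f (γ t)‖ - 1 / 2) ^ 2 + 3 / 4) := by
      field_simp
      ring
    have h3 : 0 ≤ κ⁻¹ * ((κ * ‖grad (E := E) f (γ t)‖ - 1 / 2) ^ 2 + 3 / 4) := by positivity
    linarith
  · exact hcont.continuousOn.integrableOn_Icc
  · filter_upwards with t
    positivity

/-- A sequence of flow lines along which `f` is uniformly bounded converges pointwise to a flow
line as soon as it converges at time `0`: the set of times at which it converges is open by
continuous dependence on the initial point, and closed by the bound on the length and
completeness. -/
theorem exists_limit_flowLine [CompleteSpace M] (hf : ContMDiff 𝓘(ℝ, E) 𝓘(ℝ, ℝ) ∞ f)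
    {ξ : ℕ → ℝ → M} (hξ : ∀ n, IsFlowLine (E := E) f (ξ n)) {a b : ℝ}
    (hab : ∀ n t, f (ξ n t) ∈ Icc a b) {w : M} (hw : Tendsto (fun n ↦ ξ n 0) atTop (𝓝 w)) :
    ∃ γ : ℝ → M, IsFlowLine (E := E) f γ ∧
      ∀ t, Tendsto (fun n ↦ ξ n t) atTop (𝓝 (γ t)) := by
  have hloc : ∀ t₀ x, Tendsto (fun n ↦ ξ n t₀) atTop (𝓝 x) → ∃ ε > 0, ∃ Φ : ℝ → M,
      IsMIntegralCurveOn (I := 𝓘(ℝ, E)) Φ (fun x ↦ -grad (E := E) f x) (Ioo (-ε) ε) ∧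
      ∀ t ∈ Ioo (t₀ - ε) (t₀ + ε), Tendsto (fun n ↦ ξ n t) atTop (𝓝 (Φ (t - t₀))) := by
    intro t₀ x hx
    obtain ⟨ε, hε, Φ, hΦ, h⟩ := exists_local_limit_flowLine (E := E) hf x
    refine ⟨ε, hε, Φ, hΦ, fun t ht ↦ ?_⟩
    have := h (fun n ↦ ξ n ∘ (· + t₀)) (fun n ↦ (hξ n).comp_add t₀) (by simpa using hx) (t - t₀)
      ⟨by linarith [ht.1], by linarith [ht.2]⟩
    simpa using this
  set S : Set ℝ := {t | ∃ x, Tendsto (fun n ↦ ξ n t) atTop (𝓝 x)} with hS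
  have hopen : IsOpen S := by
    rw [isOpen_iff_mem_nhds]
    rintro t₀ ⟨x, hx⟩
    obtain ⟨ε, hε, Φ, -, h⟩ := hloc t₀ x hx
    filter_upwards [Ioo_mem_nhds (sub_lt_self t₀ hε) (lt_add_of_pos_right t₀ hε)] with t ht
    exact ⟨_, h t ht⟩
  have hclosed : IsClosed S := by
    refine isClosed_of_closure_subset fun t ht ↦ ?_
    refine cauchySeq_tendsto_of_complete (EMetric.cauchySeq_iff.2 fun η hη ↦ ?_)
    obtain ⟨e, he, heη⟩ : ∃ e : ℝ, 0 < e ∧ ENNReal.ofReal e < η / 3 := by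
      obtain ⟨e, he0, he1⟩ := ENNReal.lt_iff_exists_nnreal_btwn.1
        (ENNReal.div_pos hη.ne' (by simp : (3 : ENNReal) ≠ ⊤))
      exact ⟨e, by simpa using he0, by simpa using he1⟩
    have hba : a ≤ b := (hab 0 0).1.trans (hab 0 0).2
    set κ : ℝ := e / 2 / (b - a + 1) with hκ
    have hκpos : 0 < κ := div_pos (by positivity) (by linarith)
    have hκb : κ * (b - a) ≤ e / 2 := by
      rw [hκ, div_mul_eq_mul_div, div_le_iff₀ (by linarith)]
      nlinarith
    have hstep : ∀ n s s', s ≤ s' → s' - s ≤ κ * (e / 2) →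
        edist (ξ n s) (ξ n s') ≤ ENNReal.ofReal e := by
      intro n s s' hss hs'
      refine ((hξ n).edist_le hf hκpos hss).trans (ENNReal.ofReal_le_ofReal ?_)
      have h1 : κ⁻¹ * (s' - s) ≤ e / 2 := by
        rw [inv_mul_le_iff₀ hκpos]
        exact hs'
      have h2 : κ * (f (ξ n s) - f (ξ n s')) ≤ κ * (b - a) := by
        gcongr
        · exact (hab n s).2
        · exact (hab n s').1
      linarith
    obtain ⟨s, ⟨x, hx⟩, hs⟩ := Metric.mem_closure_iff.1 ht (κ * (e / 2)) (by positivity)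
    have hstep' : ∀ n, edist (ξ n t) (ξ n s) ≤ ENNReal.ofReal e := by
      intro n
      rw [Real.dist_eq] at hs
      obtain ⟨hs1, hs2⟩ := abs_lt.1 hs
      rcases le_total t s with h | h
      · exact hstep n t s h (by linarith)
      · rw [edist_comm]
        exact hstep n s t h (by linarith)
    obtain ⟨N, hN⟩ := EMetric.cauchySeq_iff.1 hx.cauchySeq (η / 3)
      (ENNReal.div_pos hη.ne' (by simp))
    refine ⟨N, fun m hm n hn ↦ ?_⟩
    calc edist (ξ m t) (ξ n t)
        ≤ edist (ξ m t) (ξ m s) + edist (ξ m s) (ξ n s) + edist (ξ n s) (ξ n t) :=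
          edist_triangle4 _ _ _ _
      _ < η / 3 + η / 3 + η / 3 := by
          refine ENNReal.add_lt_add (ENNReal.add_lt_add ?_ (hN m hm n hn)) ?_
          · exact (hstep' m).trans_lt heη
          · rw [edist_comm]
            exact (hstep' n).trans_lt heη
      _ = η := ENNReal.add_thirds η
  have huniv : S = univ := IsClopen.eq_univ ⟨hclosed, hopen⟩ ⟨0, w, hw⟩
  have hall : ∀ t, ∃ x, Tendsto (fun n ↦ ξ n t) atTop (𝓝 x) := fun t ↦ by
    have : t ∈ S := huniv ▸ mem_univ t
    exact this
  choose γ hγ using hall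
  refine ⟨γ, fun t₀ ↦ ?_, hγ⟩
  obtain ⟨ε, hε, Φ, hΦ, h⟩ := hloc t₀ _ (hγ t₀)
  have h1 : IsMIntegralCurveAt (I := 𝓘(ℝ, E)) Φ (fun x ↦ -grad (E := E) f x) 0 :=
    hΦ.isMIntegralCurveAt (Ioo_mem_nhds (by linarith) hε)
  have h2 : IsMIntegralCurveAt (I := 𝓘(ℝ, E)) (Φ ∘ (· + -t₀)) (fun x ↦ -grad (E := E) f x) t₀ := by
    have := h1.comp_add (-t₀)
    rwa [sub_neg_eq_add, zero_add] at this
  have h3 : γ =ᶠ[𝓝 t₀] Φ ∘ (· + -t₀) := by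
    filter_upwards [Ioo_mem_nhds (sub_lt_self t₀ hε) (lt_add_of_pos_right t₀ hε)] with t ht
    exact tendsto_nhds_unique (hγ t) (h t ht)
  have h4 := h2.hasMFDerivAt.congr_of_eventuallyEq h3
  rwa [← h3.eq_of_nhds] at h4

end GlobalLimit

/-! ### Nondegenerate quadratic forms of finite index -/

section QuadraticForm

variable {E : Type*} [NormedAddCommGroup E] [NormedSpace ℝ E]

/-- A finite-dimensional subspace on which `H` is definite is the range of a continuous projection
along its `H`-orthogonal complement. -/
lemma exists_orthogonal_projection (H : E →L[ℝ] E →L[ℝ] ℝ) (W : Submodule ℝ E)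
    [FiniteDimensional ℝ W] (hW : ∀ v ∈ W, v ≠ 0 → H v v < 0) :
    ∃ P : E →L[ℝ] W, ∀ u, ∀ w ∈ W, H (u - P u) w = 0 := by
  set R : E →L[ℝ] (W →L[ℝ] ℝ) :=
    (ContinuousLinearMap.compL ℝ W E ℝ).flip W.subtypeL ∘L H with hR
  have hRa : ∀ u (w : W), R u w = H u w := fun u w ↦ rfl
  set A : W →ₗ[ℝ] (W →L[ℝ] ℝ) := (R ∘L W.subtypeL).toLinearMap with hA
  have hinj : Function.Injective A := by
    refine (injective_iff_map_eq_zero _).2 fun w hw ↦ ?_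
    by_contra hne
    have h1 := hW w w.2 (by simpa using hne)
    have h2 : A w w = H w w := rfl
    rw [hw] at h2
    simp [← h2] at h1
  have hfin : FiniteDimensional ℝ (W →L[ℝ] ℝ) := inferInstance
  have hdim : Module.finrank ℝ W = Module.finrank ℝ (W →L[ℝ] ℝ) := by
    rw [← (LinearMap.toContinuousLinearMap (𝕜 := ℝ) (E := W) (F' := ℝ)).finrank_eq]
    exact (Subspace.dual_finrank_eq (K := ℝ) (V := W)).symm
  set B := (LinearEquiv.ofInjectiveOfFinrankEq A hinj hdim) with hB
  set B' := B.toContinuousLinearEquiv with hB'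
  refine ⟨(B'.symm : (W →L[ℝ] ℝ) →L[ℝ] W) ∘L R, fun u w hw ↦ ?_⟩
  have h1 : A (B'.symm (R u)) = R u := B.apply_symm_apply (R u)
  have h2 := congrArg (fun l ↦ l ⟨w, hw⟩) h1
  have h3 : A (B'.symm (R u)) ⟨w, hw⟩ = H (B'.symm (R u)) w := rfl
  rw [map_sub, sub_apply, sub_eq_zero]
  simp only [h3] at h2
  exact h2.symm

/-- Among the subspaces on which a form of finite index is negative definite there is one of
maximal dimension; the form is nonnegative on its orthogonal complement. -/
lemma exists_maximal_negative_subspace (H : E →L[ℝ] E →L[ℝ] ℝ) (hsymm : ∀ u v, H u v = H v u)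
    (hind : ⨆ W : {W : Submodule ℝ E // ∀ v ∈ W, v ≠ 0 → H v v < 0},
      Cardinal.toENat (Module.rank ℝ W.1) < ⊤) :
    ∃ W : Submodule ℝ E, FiniteDimensional ℝ W ∧ (∀ v ∈ W, v ≠ 0 → H v v < 0) ∧
      ∀ v, (∀ w ∈ W, H v w = 0) → 0 ≤ H v v := by
  have : Nonempty {W : Submodule ℝ E // ∀ v ∈ W, v ≠ 0 → H v v < 0} :=
    ⟨⊥, fun v hv hv0 ↦ absurd ((Submodule.mem_bot ℝ).1 hv) hv0⟩
  have hle := le_iSup (fun W : {W : Submodule ℝ E // ∀ v ∈ W, v ≠ 0 → H v v < 0} ↦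
      Cardinal.toENat (Module.rank ℝ W.1))
  have hfin : ∀ W : {W : Submodule ℝ E // ∀ v ∈ W, v ≠ 0 → H v v < 0},
      FiniteDimensional ℝ W.1 := by
    intro W
    have h1 := (hle W).trans_lt hind
    rw [lt_top_iff_ne_top, Ne, Cardinal.toENat_eq_top, not_le] at h1
    exact Module.rank_lt_aleph0_iff.1 h1
  obtain ⟨W, hWmax⟩ := ENat.exists_eq_iSup_of_lt_top hind
  have := hfin W
  refine ⟨W.1, this, W.2, fun v hv ↦ ?_⟩
  by_contra hneg
  push Not at hneg
  have hW' : ∀ x ∈ W.1 ⊔ Submodule.span ℝ {v}, x ≠ 0 → H x x < 0 := by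
    intro x hx hx0
    obtain ⟨w, hw, z, hz, rfl⟩ := Submodule.mem_sup.1 hx
    obtain ⟨t, rfl⟩ := Submodule.mem_span_singleton.1 hz
    have h1 : H (w + t • v) (w + t • v) = H w w + t ^ 2 * H v v := by
      have h2 := hv w hw
      have h3 := hsymm w v
      simp only [map_add, map_smul, add_apply, smul_apply, smul_eq_mul]
      rw [h3, h2]
      ring
    rw [h1]
    by_cases hw0 : w = 0
    · have ht : t ≠ 0 := by
        rintro rfl
        simp [hw0] at hx0
      have : 0 < t ^ 2 := by positivity
      simp only [hw0, map_zero, zero_add]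
      exact mul_neg_of_pos_of_neg this hneg
    · have h4 := W.2 w hw hw0
      nlinarith [sq_nonneg t]
  have hlt : W.1 < W.1 ⊔ Submodule.span ℝ {v} := by
    refine left_lt_sup.2 fun h ↦ ?_
    have h1 : v ∈ W.1 := h (Submodule.mem_span_singleton_self v)
    have h2 := hv v h1
    linarith
  have hfd := hfin ⟨_, hW'⟩
  have h1 := hle ⟨_, hW'⟩
  rw [← hWmax] at h1
  have h2 := Submodule.finrank_lt_finrank_of_lt hlt
  simp only [← Module.finrank_eq_rank, Cardinal.toENat_nat, Nat.cast_le] at h1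
  omega

/-- A nondegenerate form of finite index is positive definite up to a form of finite rank. The
positivity on the complement of a maximal negative subspace is uniform, by the Cauchy–Schwarz
inequality and because `H` is bounded below as a map into the dual. -/
theorem exists_finite_rank_coercive [CompleteSpace E] (H : E →L[ℝ] E →L[ℝ] ℝ)
    (hsymm : ∀ u v, H u v = H v u) (hbij : Function.Bijective H)
    (hind : ⨆ W : {W : Submodule ℝ E // ∀ v ∈ W, v ≠ 0 → H v v < 0},
      Cardinal.toENat (Module.rank ℝ W.1) < ⊤) :
    ∃ (W : Submodule ℝ E) (P : E →L[ℝ] W) (c C : ℝ), FiniteDimensional ℝ W ∧ 0 < c ∧ 0 ≤ C ∧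
      ∀ u, c * ‖u‖ ^ 2 ≤ H u u + C * ‖P u‖ ^ 2 := by
  obtain ⟨W, hWf, hWneg, hWpos⟩ := exists_maximal_negative_subspace H hsymm hind
  obtain ⟨P, hP⟩ := exists_orthogonal_projection H W hWneg
  set e : E ≃L[ℝ] (E →L[ℝ] ℝ) := ContinuousLinearEquiv.ofBijective H
    (LinearMap.ker_eq_bot.2 hbij.1) (LinearMap.range_eq_top.2 hbij.2) with he
  set m : ℝ := ‖(e.symm : (E →L[ℝ] ℝ) →L[ℝ] E)‖ with hm
  have hlow : ∀ u, ‖u‖ ≤ m * ‖H u‖ := by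
    intro u
    have h := (e.symm : (E →L[ℝ] ℝ) →L[ℝ] E).le_opNorm (H u)
    have h2 : e.symm (H u) = u := e.symm_apply_apply u
    simpa [h2] using h
  set K : ℝ := ‖H‖ * (1 + ‖P‖) ^ 2 with hK
  -- Cauchy–Schwarz on the complement, where the form is nonnegative
  have hCS : ∀ v z, (∀ w ∈ W, H v w = 0) → (∀ w ∈ W, H z w = 0) →
      H v z ^ 2 ≤ H v v * H z z := by
    intro v z hv hz
    have hd : discrim (H z z) (2 * H v z) (H v v) ≤ 0 := by
      refine discrim_le_zero fun t ↦ ?_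
      have h := hWpos (v + t • z) (fun w hw ↦ by simp [hv w hw, hz w hw])
      have h' : H (v + t • z) (v + t • z) = H z z * (t * t) + 2 * H v z * t + H v v := by
        simp only [map_add, map_smul, add_apply, smul_apply, smul_eq_mul]
        rw [hsymm z v]
        ring
      linarith
    rw [discrim] at hd
    nlinarith
  have hbound : ∀ v, (∀ w ∈ W, H v w = 0) → ‖v‖ ^ 2 ≤ m ^ 2 * K * H v v := by
    intro v hv
    have hvv := hWpos v hv
    have h1 : ‖H v‖ ≤ Real.sqrt (K * H v v) := by
      refine ContinuousLinearMap.opNorm_le_bound _ (Real.sqrt_nonneg _) fun z ↦ ?_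
      have h2 : H v z = H v (z - P z) := by
        rw [map_sub, hv (P z) (P z).2, sub_zero]
      have h3 := hCS v (z - P z) hv (hP z)
      have h4 : H (z - P z) (z - P z) ≤ K * ‖z‖ ^ 2 := by
        have h5 : ‖z - P z‖ ≤ (1 + ‖P‖) * ‖z‖ := by
          refine (norm_sub_le _ _).trans ?_
          have := P.le_opNorm z
          rw [Submodule.coe_norm] at this
          linarith
        calc H (z - P z) (z - P z) ≤ ‖H (z - P z) (z - P z)‖ := le_abs_self _
          _ ≤ ‖H‖ * ‖z - P z‖ * ‖z - P z‖ := H.le_opNorm₂ _ _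
          _ ≤ ‖H‖ * ((1 + ‖P‖) * ‖z‖) * ((1 + ‖P‖) * ‖z‖) := by gcongr
          _ = K * ‖z‖ ^ 2 := by rw [hK]; ring
      rw [Real.norm_eq_abs, h2, ← Real.sqrt_sq (norm_nonneg z), ← Real.sqrt_mul (by positivity)]
      refine Real.abs_le_sqrt (h3.trans ?_)
      calc H v v * H (z - P z) (z - P z) ≤ H v v * (K * ‖z‖ ^ 2) := by gcongr
        _ = K * H v v * ‖z‖ ^ 2 := by ring
    have hKnn : 0 ≤ K := by positivity
    calc ‖v‖ ^ 2 ≤ (m * ‖H v‖) ^ 2 := by gcongr; exact hlow v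
      _ ≤ (m * Real.sqrt (K * H v v)) ^ 2 := by gcongr
      _ = m ^ 2 * K * H v v := by
        rw [mul_pow, Real.sq_sqrt (by positivity)]; ring
  set D : ℝ := m ^ 2 * K + 1 with hD
  have hDpos : 0 < D := by positivity
  refine ⟨W, P, (2 * D)⁻¹, D⁻¹ + ‖H‖, hWf, by positivity, by positivity, fun u ↦ ?_⟩
  set v := u - P u with hv
  have hvW : ∀ w ∈ W, H v w = 0 := hP u
  have h1 : ‖v‖ ^ 2 ≤ D * H v v := by
    have := hWpos v hvW
    nlinarith [hbound v hvW]
  have h2 : H u u = H (P u) (P u) + H v v := by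
    have h3 : u = P u + v := by simp [hv]
    have h4 := hvW (P u) (P u).2
    have h5 := hsymm (P u) v
    conv_lhs => rw [h3]
    simp only [map_add, add_apply]
    rw [h5, h4]
    ring
  have h3 : -(‖H‖ * ‖P u‖ ^ 2) ≤ H (P u) (P u) := by
    have h4 := H.le_opNorm₂ (P u) (P u)
    rw [Real.norm_eq_abs] at h4
    have h5 := neg_abs_le (H (P u) (P u))
    rw [Submodule.coe_norm]
    nlinarith
  have h4 : ‖u‖ ^ 2 ≤ 2 * ‖v‖ ^ 2 + 2 * ‖P u‖ ^ 2 := by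
    have h5 : ‖u‖ ≤ ‖v‖ + ‖P u‖ := by
      have := norm_add_le v (P u : E)
      rwa [hv, sub_add_cancel, ← hv, ← Submodule.coe_norm] at this
    have h6 := norm_nonneg u
    nlinarith [sq_nonneg (‖v‖ - ‖P u‖), norm_nonneg v, norm_nonneg (P u)]
  rw [inv_mul_le_iff₀ (by positivity)]
  have h5 : 2 * D * (H u u + (D⁻¹ + ‖H‖) * ‖P u‖ ^ 2) =
      2 * (D * H v v) + 2 * ‖P u‖ ^ 2 + 2 * D * (H (P u) (P u) + ‖H‖ * ‖P u‖ ^ 2) := by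
    rw [h2]
    field_simp
    ring
  have h6 : 0 ≤ 2 * D * (H (P u) (P u) + ‖H‖ * ‖P u‖ ^ 2) :=
    mul_nonneg (by positivity) (by linarith)
  linarith

end QuadraticForm

/-! ### Dynamics near a hyperbolic zero of a vector field -/

section Hyperbolic

variable {E : Type*} [NormedAddCommGroup E] [NormedSpace ℝ E]

lemma exists_ball_strict_approx {F : Type*} [NormedAddCommGroup F] [NormedSpace ℝ F]
    {X : E → F} {L : E →L[ℝ] F} {y₀ : E} (hX : HasStrictFDerivAt X L y₀) {η : ℝ} (hη : 0 < η) :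
    ∃ δ > 0, ∀ y ∈ Metric.ball y₀ δ, ∀ y' ∈ Metric.ball y₀ δ,
      ‖X y - X y' - L (y - y')‖ ≤ η * ‖y - y'‖ := by
  have h := hX.isLittleO.def hη
  obtain ⟨δ, hδ, h'⟩ := Metric.eventually_nhds_iff_ball.1 h
  refine ⟨δ, hδ, fun y hy y' hy' ↦ h' (y, y') ?_⟩
  rw [← ball_prod_same]
  exact ⟨hy, hy'⟩

/-- Suppose that `X` vanishes at `y₀` and that the derivative `H` of a field `D` of linear forms,
vanishing at `y₀`, decreases strictly along the linearization `L` of `X`. Then, near `y₀`, the form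
`H` decreases strictly along the difference of two orbits of `X`, and `D` is strictly negative
on `X`. -/
lemma exists_hyperbolic_ball {X : E → E} {L : E →L[ℝ] E} {D : E → E →L[ℝ] ℝ}
    {H : E →L[ℝ] E →L[ℝ] ℝ} {y₀ : E} (hX : HasStrictFDerivAt X L y₀)
    (hD : HasStrictFDerivAt D H y₀) (hX0 : X y₀ = 0) (hD0 : D y₀ = 0) {c : ℝ} (hc : 0 < c)
    (hL : ∀ u, H u (L u) ≤ -(2 * c) * ‖u‖ ^ 2) :
    ∃ δ > 0, ∃ K > 0, ∀ y ∈ Metric.ball y₀ δ,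
      (∀ y' ∈ Metric.ball y₀ δ, H (y - y') (X y - X y') ≤ -c * ‖y - y'‖ ^ 2) ∧
      (∀ y' ∈ Metric.ball y₀ δ, ‖X y - X y'‖ ≤ K * ‖y - y'‖) ∧
      D y (X y) ≤ -c * ‖y - y₀‖ ^ 2 := by
  set K : ℝ := ‖L‖ + 1 with hK
  have hKpos : 0 < K := by positivity
  set η : ℝ := min 1 (c / (‖H‖ + K)) with hη
  have hHK : 0 < ‖H‖ + K := by positivity
  have hηpos : 0 < η := lt_min one_pos (div_pos hc hHK)
  have hη1 : η ≤ 1 := min_le_left _ _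
  have hη2 : η * (‖H‖ + K) ≤ c := by
    rw [← le_div_iff₀ hHK]
    exact min_le_right _ _
  obtain ⟨δ₁, hδ₁, h₁⟩ := exists_ball_strict_approx hX hηpos
  obtain ⟨δ₂, hδ₂, h₂⟩ := exists_ball_strict_approx hD hηpos
  have hsub₁ : Metric.ball y₀ (min δ₁ δ₂) ⊆ Metric.ball y₀ δ₁ :=
    Metric.ball_subset_ball (min_le_left _ _)
  have hsub₂ : Metric.ball y₀ (min δ₁ δ₂) ⊆ Metric.ball y₀ δ₂ :=
    Metric.ball_subset_ball (min_le_right _ _)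
  have hlip : ∀ y ∈ Metric.ball y₀ (min δ₁ δ₂), ∀ y' ∈ Metric.ball y₀ (min δ₁ δ₂),
      ‖X y - X y'‖ ≤ K * ‖y - y'‖ := by
    intro y hy y' hy'
    have h := h₁ y (hsub₁ hy) y' (hsub₁ hy')
    have h' := norm_add_le (X y - X y' - L (y - y')) (L (y - y'))
    rw [sub_add_cancel] at h'
    have h'' := L.le_opNorm (y - y')
    have h3 : η * ‖y - y'‖ ≤ 1 * ‖y - y'‖ := by gcongr
    rw [hK]
    linarith
  refine ⟨min δ₁ δ₂, lt_min hδ₁ hδ₂, K, hKpos, fun y hy ↦ ⟨fun y' hy' ↦ ?_, hlip y hy, ?_⟩⟩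
  · set u := y - y' with hu
    have h := h₁ y (hsub₁ hy) y' (hsub₁ hy')
    have h3 : H u (X y - X y') = H u (L u) + H u (X y - X y' - L u) := by
      rw [← map_add, add_sub_cancel]
    have h4 : H u (X y - X y' - L u) ≤ ‖H‖ * ‖u‖ * (η * ‖u‖) := by
      refine (le_abs_self _).trans ((H.le_opNorm₂ _ _).trans ?_)
      gcongr
    have h5 := hL u
    have h6 : η * ‖H‖ ≤ c := by nlinarith
    rw [h3]
    nlinarith [sq_nonneg ‖u‖, mul_le_mul_of_nonneg_right h6 (sq_nonneg ‖u‖)]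
  · have hy₀ : y₀ ∈ Metric.ball y₀ (min δ₁ δ₂) := Metric.mem_ball_self (lt_min hδ₁ hδ₂)
    set u := y - y₀ with hu
    have h := h₁ y (hsub₁ hy) y₀ (hsub₁ hy₀)
    have h' := h₂ y (hsub₂ hy) y₀ (hsub₂ hy₀)
    have h'' := hlip y hy y₀ hy₀
    rw [hX0, sub_zero] at h h''
    rw [hD0, sub_zero] at h'
    have h3 : D y (X y) = H u (L u) + (D y - H u) (X y) + H u (X y - L u) := by
      rw [sub_apply, (H u).map_sub]
      ring
    have h4 : H u (X y - L u) ≤ ‖H‖ * ‖u‖ * (η * ‖u‖) := by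
      refine (le_abs_self _).trans ((H.le_opNorm₂ _ _).trans ?_)
      gcongr
    have h5 : (D y - H u) (X y) ≤ η * ‖u‖ * (K * ‖u‖) := by
      refine (le_abs_self _).trans (((D y - H u).le_opNorm _).trans ?_)
      gcongr
    have h6 := hL u
    rw [h3]
    nlinarith [mul_le_mul_of_nonneg_right hη2 (sq_nonneg ‖u‖)]

/-- If a symmetric form `H` decreases strictly along differences of orbits of `X`, then on the
difference of two orbits it is bounded above by an exponentially decreasing function of time. -/
lemma form_diff_orbits_le {X : E → E} {H : E →L[ℝ] E →L[ℝ] ℝ} (hsymm : ∀ u v, H u v = H v u)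
    {s : Set E} {c : ℝ} (hc : 0 < c)
    (hH : ∀ y ∈ s, ∀ y' ∈ s, H (y - y') (X y - X y') ≤ -c * ‖y - y'‖ ^ 2)
    {α β : ℝ → E} {a b : ℝ} (hab : a ≤ b)
    (hα : ∀ t ∈ Icc a b, α t ∈ s ∧ HasDerivAt α (X (α t)) t)
    (hβ : ∀ t ∈ Icc a b, β t ∈ s ∧ HasDerivAt β (X (β t)) t) :
    H (α b - β b) (α b - β b) ≤
      Real.exp (-(2 * c / (‖H‖ + 1)) * (b - a)) * H (α a - β a) (α a - β a) := by
  set κ : ℝ := 2 * c / (‖H‖ + 1) with hκ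
  have hHpos : 0 < ‖H‖ + 1 := by positivity
  have hκH : κ * ‖H‖ ≤ 2 * c := by
    have h1 : κ * (‖H‖ + 1) = 2 * c := div_mul_cancel₀ _ hHpos.ne'
    have h2 : 0 < κ := by positivity
    nlinarith
  have hκpos : 0 < κ := by positivity
  set u : ℝ → E := fun t ↦ α t - β t with hu
  have hd : ∀ t ∈ Icc a b, HasDerivAt (fun t ↦ Real.exp (κ * t) * H (u t) (u t))
      (Real.exp (κ * t) * (κ * H (u t) (u t) + 2 * H (u t) (X (α t) - X (β t)))) t := by
    intro t ht
    have h1 : HasDerivAt u (X (α t) - X (β t)) t := (hα t ht).2.sub (hβ t ht).2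
    have h2 : HasDerivAt (fun t ↦ H (u t) (u t))
        (H (X (α t) - X (β t)) (u t) + H (u t) (X (α t) - X (β t))) t :=
      (H.hasFDerivAt.comp_hasDerivAt t h1).clm_apply h1
    have h3 : HasDerivAt (fun t ↦ Real.exp (κ * t)) (Real.exp (κ * t) * κ) t := by
      simpa using ((hasDerivAt_id t).const_mul κ).exp
    refine (h3.mul h2).congr_deriv ?_
    rw [hsymm (X (α t) - X (β t)) (u t)]
    ring
  have hanti : AntitoneOn (fun t ↦ Real.exp (κ * t) * H (u t) (u t)) (Icc a b) := by
    refine antitoneOn_of_hasDerivWithinAt_nonpos (convex_Icc a b)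
      (fun t ht ↦ (hd t ht).continuousAt.continuousWithinAt)
      (fun t ht ↦ (hd t (interior_subset ht)).hasDerivWithinAt) (fun t ht ↦ ?_)
    have ht' := interior_subset ht
    have h1 := hH _ (hα t ht').1 _ (hβ t ht').1
    have h2 : H (u t) (u t) ≤ ‖H‖ * ‖u t‖ ^ 2 := by
      refine (le_abs_self _).trans ((H.le_opNorm₂ _ _).trans (le_of_eq ?_))
      ring
    refine mul_nonpos_of_nonneg_of_nonpos (Real.exp_pos _).le ?_
    have h3 : κ * H (u t) (u t) ≤ 2 * c * ‖u t‖ ^ 2 :=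
      calc κ * H (u t) (u t) ≤ κ * (‖H‖ * ‖u t‖ ^ 2) := by gcongr
        _ = κ * ‖H‖ * ‖u t‖ ^ 2 := by ring
        _ ≤ 2 * c * ‖u t‖ ^ 2 := by gcongr
    change H (u t) _ ≤ -c * ‖u t‖ ^ 2 at h1
    linarith
  have h := hanti (left_mem_Icc.2 hab) (right_mem_Icc.2 hab) hab
  have h2 : Real.exp (-κ * (b - a)) = (Real.exp (κ * b))⁻¹ * Real.exp (κ * a) := by
    rw [← Real.exp_neg, ← Real.exp_add]
    ring_nf
  rw [h2, mul_assoc, le_inv_mul_iff₀ (Real.exp_pos _)]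
  exact h

/-- A solution of a differential equation leaves a zero of the vector field at most
exponentially fast. -/
lemma norm_orbit_sub_le {X : E → E} {y₀ : E} {s : Set E} {K : ℝ}
    (hX : ∀ y ∈ s, ‖X y‖ ≤ K * ‖y - y₀‖) {α : ℝ → E} {a b : ℝ} (hab : a ≤ b)
    (hα : ∀ t ∈ Icc a b, α t ∈ s ∧ HasDerivAt α (X (α t)) t) :
    ‖α b - y₀‖ ≤ ‖α a - y₀‖ * Real.exp (K * (b - a)) := by
  have h := norm_le_gronwallBound_of_norm_deriv_right_le (f := fun t ↦ α t - y₀)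
    (f' := fun t ↦ X (α t)) (δ := ‖α a - y₀‖) (K := K) (ε := 0) (a := a) (b := b)
    (fun t ht ↦ ((hα t ht).2.sub_const y₀).continuousAt.continuousWithinAt)
    (fun t ht ↦ ((hα t (Ico_subset_Icc_self ht)).2.sub_const y₀).hasDerivWithinAt) le_rfl
    (fun t ht ↦ by simpa using hX _ (hα t (Ico_subset_Icc_self ht)).1) b (right_mem_Icc.2 hab)
  rwa [gronwallBound_ε0] at h

/-- A bounded sequence on whose differences a form of finite negative rank is asymptotically
nonpositive has a convergent subsequence. -/
lemma exists_tendsto_subseq_of_form_le [CompleteSpace E] {H : E →L[ℝ] E →L[ℝ] ℝ}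
    {W : Submodule ℝ E} [FiniteDimensional ℝ W] {P : E →L[ℝ] W} {c C : ℝ} (hc : 0 < c)
    (hP : ∀ u, c * ‖u‖ ^ 2 ≤ H u u + C * ‖P u‖ ^ 2) {w : ℕ → E} {y₀ : E} {δ : ℝ}
    (hw : ∀ n, w n ∈ Metric.closedBall y₀ δ)
    (hH : ∀ ε > 0, ∃ N, ∀ n ≥ N, ∀ m ≥ N, H (w n - w m) (w n - w m) ≤ ε) :
    ∃ (ψ : ℕ → ℕ) (y : E), StrictMono ψ ∧ Tendsto (w ∘ ψ) atTop (𝓝 y) := by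
  have : ProperSpace W := FiniteDimensional.proper_real W
  have hbd : Bornology.IsBounded (P '' Metric.closedBall y₀ δ) :=
    P.lipschitz.isBounded_image Metric.isBounded_closedBall
  obtain ⟨z, -, ψ, hψ, hz⟩ := tendsto_subseq_of_bounded hbd (x := fun n ↦ P (w n))
    (fun n ↦ mem_image_of_mem _ (hw n))
  have hcauchy : CauchySeq (w ∘ ψ) := by
    refine Metric.cauchySeq_iff.2 fun ε hε ↦ ?_
    obtain ⟨N₁, hN₁⟩ := hH (c * ε ^ 2 / 2) (by positivity)
    set η : ℝ := c * ε ^ 2 / 2 / (|C| + 1) with hη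
    have hηpos : 0 < η := by positivity
    obtain ⟨N₂, hN₂⟩ := Metric.cauchySeq_iff.1 hz.cauchySeq (Real.sqrt η) (by positivity)
    refine ⟨max N₁ N₂, fun m hm n hn ↦ ?_⟩
    have h1 := hN₁ (ψ m) ((le_max_left _ _).trans (hm.le.trans (hψ.id_le m))) (ψ n)
      ((le_max_left _ _).trans (hn.le.trans (hψ.id_le n)))
    have h2 := hN₂ m ((le_max_right _ _).trans hm) n ((le_max_right _ _).trans hn)
    have h3 := hP (w (ψ m) - w (ψ n))
    simp only [Function.comp_apply, dist_eq_norm] at h2 ⊢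
    rw [P.map_sub] at h3
    have h4 : ‖P (w (ψ m)) - P (w (ψ n))‖ ^ 2 < η := by
      rw [← Real.sq_sqrt hηpos.le]
      gcongr
    have h5 : C * ‖P (w (ψ m)) - P (w (ψ n))‖ ^ 2 < c * ε ^ 2 / 2 := by
      have h6 : (|C| + 1) * ‖P (w (ψ m)) - P (w (ψ n))‖ ^ 2 < c * ε ^ 2 / 2 := by
        rwa [hη, lt_div_iff₀ (by positivity), mul_comm] at h4
      have h7 := le_abs_self C
      have h8 := sq_nonneg ‖P (w (ψ m)) - P (w (ψ n))‖
      nlinarith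
    have h6 : c * ‖w (ψ m) - w (ψ n)‖ ^ 2 < c * ε ^ 2 := by linarith
    exact lt_of_pow_lt_pow_left₀ 2 hε.le (lt_of_mul_lt_mul_left h6 hc.le)
  obtain ⟨y, hy⟩ := cauchySeq_tendsto_of_complete hcauchy
  exact ⟨ψ, y, hψ, hy⟩

end Hyperbolic

/-! ### Flow lines near a nondegenerate critical point -/

section CriticalPoint

/-- A continuous curve that leaves an open set `U` does so at a first time, up to which it stays in
any closed set that contains `U`. -/
lemma exists_first_exit {X : Type*} [TopologicalSpace X] {γ : ℝ → X} (hγ : Continuous γ)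
    {U N : Set X} (hU : IsOpen U) (hN : IsClosed N) (hUN : U ⊆ N) {a b : ℝ} (hab : a ≤ b)
    (ha : γ a ∈ U) (hb : γ b ∉ U) :
    ∃ e ∈ Ioc a b, (∀ t ∈ Icc a e, γ t ∈ N) ∧ γ e ∉ U := by
  have hcomp : IsCompact (Icc a b ∩ γ ⁻¹' Uᶜ) :=
    isCompact_Icc.inter_right (hU.isClosed_compl.preimage hγ)
  obtain ⟨e, ⟨heab, heU⟩, hleast⟩ := hcomp.exists_isLeast ⟨b, right_mem_Icc.2 hab, hb⟩
  have hae : a < e := by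
    refine lt_of_le_of_ne heab.1 ?_
    rintro rfl
    exact heU ha
  refine ⟨e, ⟨hae, heab.2⟩, ?_, heU⟩
  have h1 : Ico a e ⊆ γ ⁻¹' N := by
    intro t ht
    by_contra hout
    have := hleast ⟨⟨ht.1, ht.2.le.trans heab.2⟩, fun h ↦ hout (hUN h)⟩
    exact absurd ht.2 (not_lt.2 this)
  have h2 := closure_minimal h1 (hN.preimage hγ)
  rwa [closure_Ico hae.ne] at h2

variable {E : Type*} [NormedAddCommGroup E] [InnerProductSpace ℝ E] [CompleteSpace E]
  {M : Type*} [TopologicalSpace M] [ChartedSpace E M]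
  [RiemannianBundle (fun x : M ↦ TangentSpace 𝓘(ℝ, E) x)]
  {f : M → ℝ}

variable (E) in
/-- A neighbourhood `N` of a critical point `r` is adapted if, in the chart at `r`, it lies in a
ball on which `-∇f` is `K`-Lipschitz, the Hessian at `r` decreases at rate `c` along the difference
of two orbits of `-∇f`, and `f` decreases at a rate proportional to the square of the distance
to `r`. -/
structure IsAdapted (f : M → ℝ) (r : M) (N : Set M) (δ c K : ℝ) : Prop where
  subset_source : N ⊆ (extChartAt 𝓘(ℝ, E) r).source
  mem_ball : ∀ x ∈ N, extChartAt 𝓘(ℝ, E) r x ∈ Metric.ball (extChartAt 𝓘(ℝ, E) r r) δ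
  closedBall_subset : Metric.closedBall (extChartAt 𝓘(ℝ, E) r r) δ ⊆ (extChartAt 𝓘(ℝ, E) r).target
  c_pos : 0 < c
  K_pos : 0 < K
  field_eq_zero : chartField (E := E) f r (extChartAt 𝓘(ℝ, E) r r) = 0
  symm : ∀ u v, hessian E f r u v = hessian E f r v u
  decreasing : ∀ y ∈ Metric.ball (extChartAt 𝓘(ℝ, E) r r) δ,
    ∀ y' ∈ Metric.ball (extChartAt 𝓘(ℝ, E) r r) δ,
    hessian E f r (y - y') (chartField (E := E) f r y - chartField (E := E) f r y') ≤
      -c * ‖y - y'‖ ^ 2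
  lipschitz : ∀ y ∈ Metric.ball (extChartAt 𝓘(ℝ, E) r r) δ,
    ∀ y' ∈ Metric.ball (extChartAt 𝓘(ℝ, E) r r) δ,
    ‖chartField (E := E) f r y - chartField (E := E) f r y'‖ ≤ K * ‖y - y'‖
  le_norm_grad_sq : ∀ x ∈ N, c * ‖extChartAt 𝓘(ℝ, E) r x - extChartAt 𝓘(ℝ, E) r r‖ ^ 2 ≤
    ‖grad (E := E) f x‖ ^ 2

lemma IsAdapted.mono {r : M} {N N' : Set M} {δ c K : ℝ} (h : IsAdapted E f r N δ c K)
    (hN : N' ⊆ N) : IsAdapted E f r N' δ c K :=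
  { h with
    subset_source := hN.trans h.subset_source
    mem_ball := fun x hx ↦ h.mem_ball x (hN hx)
    le_norm_grad_sq := fun x hx ↦ h.le_norm_grad_sq x (hN hx) }

/-- The only critical point in an adapted neighbourhood is its centre. -/
lemma IsAdapted.eq_of_isCritical {r : M} {N : Set M} {δ c K : ℝ} (h : IsAdapted E f r N δ c K)
    {x : M} (hx : x ∈ N) (hcrit : IsCritical E f x) : x = r := by
  have h1 := h.le_norm_grad_sq x hx
  rw [(grad_eq_zero_iff f x).2 hcrit] at h1
  have h2 : ‖(0 : TangentSpace 𝓘(ℝ, E) x)‖ = 0 := norm_zero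
  rw [h2] at h1
  have h3 : ‖extChartAt 𝓘(ℝ, E) r x - extChartAt 𝓘(ℝ, E) r r‖ ^ 2 ≤ 0 := by
    have := h.c_pos
    by_contra! hpos
    nlinarith
  have h4 : ‖extChartAt 𝓘(ℝ, E) r x - extChartAt 𝓘(ℝ, E) r r‖ = 0 := by
    nlinarith [norm_nonneg (extChartAt 𝓘(ℝ, E) r x - extChartAt 𝓘(ℝ, E) r r)]
  rw [norm_eq_zero, sub_eq_zero] at h4
  exact (extChartAt 𝓘(ℝ, E) r).injOn (h.subset_source hx) (mem_extChartAt_source r) h4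

variable [IsManifold 𝓘(ℝ, E) ∞ M]

omit [CompleteSpace E] [RiemannianBundle (fun x : M ↦ TangentSpace 𝓘(ℝ, E) x)] in
lemma hessian_symm (hf : ContMDiff 𝓘(ℝ, E) 𝓘(ℝ, ℝ) ∞ f) (r : M) (u v : E) :
    hessian E f r u v = hessian E f r v u := by
  have h := contDiffAt_comp_extChartAt_symm hf r (mem_extChartAt_target (I := 𝓘(ℝ, E)) r)
  exact (h.isSymmSndFDerivAt (by
    rw [minSmoothness_of_isRCLikeNormedField, ← one_add_one_eq_two]
    exact one_add_one_le_infty)) u v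

/-- A nondegenerate critical point has an adapted neighbourhood. In the chart the linearization of
`-∇f` is `L = -g⁻¹ H`, with `g` the metric and `H` the Hessian at the critical point, so that
`H u (L u) = -g (L u) (L u)` is negative definite. -/
theorem exists_isAdapted
    [IsContMDiffRiemannianBundle 𝓘(ℝ, E) ∞ E (fun x : M ↦ TangentSpace 𝓘(ℝ, E) x)]
    (hf : ContMDiff 𝓘(ℝ, E) 𝓘(ℝ, ℝ) ∞ f) {r : M} (hr : IsCritical E f r)
    (hbij : Function.Bijective (hessian E f r)) :
    ∃ N ∈ 𝓝 r, ∃ δ c K : ℝ, IsAdapted E f r N δ c K := by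
  set φ := extChartAt 𝓘(ℝ, E) r with hφ
  set D := fderiv ℝ (f ∘ φ.symm) with hD
  set X := chartField (E := E) f r with hX
  set H := hessian E f r with hH
  obtain ⟨G, hG1, hG⟩ := exists_chart_metric (E := E) r
  have hsrc : r ∈ φ.source := mem_extChartAt_source r
  have hX0 : X (φ r) = 0 := by
    rw [hX, chartField_extChartAt f hsrc, (grad_eq_zero_iff f r).2 hr, neg_zero, map_zero]
  have hD1 : ContDiffAt ℝ 1 D (φ r) :=
    (contDiffAt_comp_extChartAt_symm hf r (mem_extChartAt_target r)).fderiv_right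
      (m := 1) one_add_one_le_infty
  have hDs : HasStrictFDerivAt D H (φ r) := hD1.hasStrictFDerivAt one_ne_zero
  have hGX : ∀ᶠ y in 𝓝 (φ r), G y (X y) = -D y := by
    filter_upwards [extChartAt_target_mem_nhds (I := 𝓘(ℝ, E)) r] with y hy
    exact chart_metric_chartField hf hG hy
  have hD0 : D (φ r) = 0 := by
    have h := hGX.self_of_nhds
    rw [hX0, map_zero] at h
    exact (neg_eq_zero.1 h.symm)
  have hXs := (contDiffAt_chartField (E := E) hf r).hasStrictFDerivAt one_ne_zero
  set L := fderiv ℝ X (φ r) with hL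
  -- differentiate the relation `g (X y) = -D y` at the zero `φ r` of `X`
  have hGL : ∀ u, G (φ r) (L u) = -H u := by
    have h1 : HasFDerivAt (fun y ↦ G y (X y)) (-H) (φ r) :=
      hDs.hasFDerivAt.neg.congr_of_eventuallyEq hGX
    have h2 := (hG1.hasStrictFDerivAt one_ne_zero).hasFDerivAt.clm_apply hXs.hasFDerivAt
    have h3 := h1.unique h2
    intro u
    have h4 := congrArg (fun T ↦ T u) h3
    have h5 : (fderiv ℝ G (φ r) u) (X (φ r)) = 0 := by rw [hX0, map_zero]
    simp only [neg_apply, add_apply, ContinuousLinearMap.comp_apply,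
      ContinuousLinearMap.flip_apply] at h4
    exact ((add_eq_left.2 h5).symm.trans h4.symm)
  obtain ⟨c₀, hc₀, hcoer⟩ := chart_metric_coercive hG hsrc
  set e : E ≃L[ℝ] (E →L[ℝ] ℝ) := ContinuousLinearEquiv.ofBijective H
    (LinearMap.ker_eq_bot.2 hbij.1) (LinearMap.range_eq_top.2 hbij.2) with he
  set B : ℝ := ‖(e.symm : (E →L[ℝ] ℝ) →L[ℝ] E)‖ * ‖G (φ r)‖ + 1 with hB
  have hBpos : 0 < B := by positivity
  have hLlow : ∀ u, ‖u‖ ≤ B * ‖L u‖ := by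
    intro u
    have h1 := (e.symm : (E →L[ℝ] ℝ) →L[ℝ] E).le_opNorm (H u)
    have h2 : e.symm (H u) = u := e.symm_apply_apply u
    simp only [ContinuousLinearEquiv.coe_coe, h2] at h1
    have h3 : ‖H u‖ ≤ ‖G (φ r)‖ * ‖L u‖ := by
      have h4 := (G (φ r)).le_opNorm (L u)
      rwa [hGL, norm_neg] at h4
    calc ‖u‖ ≤ ‖(e.symm : (E →L[ℝ] ℝ) →L[ℝ] E)‖ * ‖H u‖ := h1
      _ ≤ ‖(e.symm : (E →L[ℝ] ℝ) →L[ℝ] E)‖ * (‖G (φ r)‖ * ‖L u‖) := by gcongr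
      _ = (B - 1) * ‖L u‖ := by rw [hB]; ring
      _ ≤ B * ‖L u‖ := by gcongr; linarith
  set c : ℝ := c₀ / B ^ 2 / 2 with hc
  have hcpos : 0 < c := by positivity
  have hHL : ∀ u, H u (L u) ≤ -(2 * c) * ‖u‖ ^ 2 := by
    intro u
    have h1 : H u (L u) = -(G (φ r) (L u) (L u)) := by
      have := congrArg (fun T ↦ T (L u)) (hGL u)
      simp only [neg_apply] at this
      linarith
    have h2 := hcoer (L u)
    have h3 : 2 * c * ‖u‖ ^ 2 ≤ c₀ * ‖L u‖ ^ 2 := by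
      calc 2 * c * ‖u‖ ^ 2 ≤ 2 * c * (B * ‖L u‖) ^ 2 := by gcongr; exact hLlow u
        _ = c₀ * ‖L u‖ ^ 2 := by rw [hc]; field_simp
    rw [h1]
    linarith
  obtain ⟨δ₁, hδ₁, K, hK, hball⟩ := exists_hyperbolic_ball hXs hDs hX0 hD0 hcpos hHL
  obtain ⟨δ₂, hδ₂, hδ₂'⟩ := Metric.nhds_basis_closedBall.mem_iff.1
    (extChartAt_target_mem_nhds (I := 𝓘(ℝ, E)) r)
  set δ := min δ₁ δ₂ with hδ
  have hsub : Metric.ball (φ r) δ ⊆ Metric.ball (φ r) δ₁ :=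
    Metric.ball_subset_ball (min_le_left _ _)
  refine ⟨φ.source ∩ φ ⁻¹' Metric.ball (φ r) δ, ?_, δ, c, K, ?_⟩
  · exact inter_mem (extChartAt_source_mem_nhds r) ((continuousAt_extChartAt r).preimage_mem_nhds
      (Metric.ball_mem_nhds _ (lt_min hδ₁ hδ₂)))
  · exact
      { subset_source := inter_subset_left
        mem_ball := fun x hx ↦ hx.2
        closedBall_subset :=
          (Metric.closedBall_subset_closedBall (min_le_right _ _)).trans hδ₂'
        c_pos := hcpos
        K_pos := hK
        field_eq_zero := hX0
        symm := hessian_symm hf r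
        decreasing := fun y hy y' hy' ↦ (hball y (hsub hy)).1 y' (hsub hy')
        lipschitz := fun y hy y' hy' ↦ (hball y (hsub hy)).2.1 y' (hsub hy')
        le_norm_grad_sq := fun x hx ↦ by
          have h1 := (hball (φ x) (hsub hx.2)).2.2
          rw [norm_grad_sq_eq_chart hf hx.1]
          linarith }

lemma IsAdapted.orbit {r : M} {N : Set M} {δ c K : ℝ} (h : IsAdapted E f r N δ c K)
    {γ : ℝ → M} (hγ : IsFlowLine (E := E) f γ) {t : ℝ} (ht : γ t ∈ N) :
    extChartAt 𝓘(ℝ, E) r (γ t) ∈ Metric.ball (extChartAt 𝓘(ℝ, E) r r) δ ∧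
    HasDerivAt (fun t ↦ extChartAt 𝓘(ℝ, E) r (γ t))
      (chartField (E := E) f r (extChartAt 𝓘(ℝ, E) r (γ t))) t :=
  ⟨h.mem_ball _ ht, hγ.hasDerivAt_chart (h.subset_source ht)⟩

omit [IsManifold 𝓘(ℝ, E) ∞ M] in
lemma IsAdapted.norm_field_le {r : M} {N : Set M} {δ c K : ℝ} (h : IsAdapted E f r N δ c K)
    {y : E} (hy : y ∈ Metric.ball (extChartAt 𝓘(ℝ, E) r r) δ) :
    ‖chartField (E := E) f r y‖ ≤ K * ‖y - extChartAt 𝓘(ℝ, E) r r‖ := by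
  have hδ : 0 < δ := Metric.pos_of_mem_ball hy
  have h1 := h.lipschitz y hy _ (Metric.mem_ball_self hδ)
  rwa [h.field_eq_zero, sub_zero] at h1

omit [CompleteSpace E] [IsManifold 𝓘(ℝ, E) ∞ M]
  [RiemannianBundle (fun x : M ↦ TangentSpace 𝓘(ℝ, E) x)] in
/-- Points of the chart domain whose coordinates are close to those of `r` are close to `r`. -/
lemma exists_pos_forall_mem_of_norm_lt (r : M) {U : Set M} (hU : U ∈ 𝓝 r) :
    ∃ η > 0, ∀ x ∈ (extChartAt 𝓘(ℝ, E) r).source,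
      ‖extChartAt 𝓘(ℝ, E) r x - extChartAt 𝓘(ℝ, E) r r‖ < η → x ∈ U := by
  have h1 : ∀ᶠ y in 𝓝 (extChartAt 𝓘(ℝ, E) r r), (extChartAt 𝓘(ℝ, E) r).symm y ∈ U := by
    have h2 := continuousAt_extChartAt_symm (I := 𝓘(ℝ, E)) r
    rw [ContinuousAt, extChartAt_to_inv] at h2
    exact h2 hU
  obtain ⟨η, hη, h⟩ := Metric.eventually_nhds_iff.1 h1
  refine ⟨η, hη, fun x hx hlt ↦ ?_⟩
  have := h (by rwa [dist_eq_norm] : dist (extChartAt 𝓘(ℝ, E) r x) _ < η)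
  rwa [(extChartAt 𝓘(ℝ, E) r).left_inv hx] at this

/-- Flow lines that stay in an adapted neighbourhood of `r` for longer and longer times up to
time `0` have, at time `0`, a convergent subsequence: the differences of their positions are
asymptotically nonpositive for the Hessian, which has finite index. -/
theorem IsAdapted.exists_tendsto_subseq {r : M} {N : Set M} {δ c K : ℝ}
    (h : IsAdapted E f r N δ c K) (hbij : Function.Bijective (hessian E f r))
    (hind : index E f r < ⊤) {ξ : ℕ → ℝ → M} (hξ : ∀ n, IsFlowLine (E := E) f (ξ n))
    (h0 : ∀ n, ξ n 0 ∈ N) (hN : ∀ T : ℝ, ∀ᶠ n in atTop, ∀ t ∈ Icc (-T) 0, ξ n t ∈ N) :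
    ∃ (ψ : ℕ → ℕ) (w : M), StrictMono ψ ∧ Tendsto (fun n ↦ ξ (ψ n) 0) atTop (𝓝 w) := by
  set φ := extChartAt 𝓘(ℝ, E) r with hφ
  set H := hessian E f r with hH
  obtain ⟨W, P, c', C, hW, hc', -, hP⟩ := exists_finite_rank_coercive H h.symm hbij hind
  have hball : ∀ n, φ (ξ n 0) ∈ Metric.closedBall (φ r) δ :=
    fun n ↦ Metric.ball_subset_closedBall (h.mem_ball _ (h0 n))
  obtain ⟨ψ, y, hψ, hy⟩ := exists_tendsto_subseq_of_form_le hc' hP hball (by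
    intro ε hε
    set κ : ℝ := 2 * c / (‖H‖ + 1) with hκ
    have hκpos : 0 < κ := div_pos (mul_pos two_pos h.c_pos) (by positivity)
    have hlim : Tendsto (fun T : ℝ ↦ Real.exp (-κ * T) * (‖H‖ * (δ + δ) ^ 2)) atTop (𝓝 0) := by
      have h1 : Tendsto (fun T : ℝ ↦ Real.exp (-κ * T)) atTop (𝓝 0) := by
        refine Real.tendsto_exp_atBot.comp ?_
        exact (tendsto_const_mul_atBot_of_neg (by linarith)).2 tendsto_id
      simpa using h1.mul_const (‖H‖ * (δ + δ) ^ 2)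
    obtain ⟨T, hT0, hT⟩ := ((eventually_ge_atTop (0 : ℝ)).and (hlim.eventually_lt_const hε)).exists
    obtain ⟨n₀, hn₀⟩ := eventually_atTop.1 (hN T)
    refine ⟨n₀, fun n hn m hm ↦ ?_⟩
    have hle := form_diff_orbits_le h.symm h.c_pos h.decreasing (neg_nonpos.2 hT0)
      (fun t ht ↦ h.orbit (hξ n) (hn₀ n hn t ht)) (fun t ht ↦ h.orbit (hξ m) (hn₀ m hm t ht))
    refine hle.trans (le_trans ?_ hT.le)
    rw [zero_sub, neg_neg]
    have hmem : ∀ k ≥ n₀, ‖φ (ξ k (-T)) - φ r‖ ≤ δ := fun k hk ↦ by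
      have := h.mem_ball _ (hn₀ k hk (-T) (left_mem_Icc.2 (neg_nonpos.2 hT0)))
      rw [Metric.mem_ball, dist_eq_norm] at this
      exact this.le
    have hδ : 0 ≤ δ := (norm_nonneg _).trans (hmem n hn)
    have hd : ‖φ (ξ n (-T)) - φ (ξ m (-T))‖ ≤ δ + δ := by
      have h1 := norm_sub_le (φ (ξ n (-T)) - φ r) (φ (ξ m (-T)) - φ r)
      rw [sub_sub_sub_cancel_right] at h1
      linarith [hmem n hn, hmem m hm]
    gcongr
    refine (le_abs_self _).trans ((H.le_opNorm₂ _ _).trans ?_)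
    rw [mul_assoc, pow_two]
    gcongr)
  have hymem : y ∈ φ.target := h.closedBall_subset
    (Metric.isClosed_closedBall.mem_of_tendsto hy (Eventually.of_forall fun n ↦ hball (ψ n)))
  refine ⟨ψ, φ.symm y, hψ, ?_⟩
  have hlim := (continuousAt_extChartAt_symm'' (I := 𝓘(ℝ, E)) hymem).tendsto.comp hy
  refine hlim.congr fun n ↦ ?_
  exact φ.left_inv (h.subset_source (h0 (ψ n)))

/-- Leaving a fixed neighbourhood of `r` takes longer and longer for flow lines that start closer
and closer to `r`. -/
theorem IsAdapted.tendsto_exit_time {r : M} {N : Set M} {δ c K : ℝ}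
    (h : IsAdapted E f r N δ c K) {ξ : ℕ → ℝ → M} (hξ : ∀ n, IsFlowLine (E := E) f (ξ n))
    {T : ℕ → ℝ} (hT : ∀ n, 0 ≤ T n) (hN : ∀ n, ∀ t ∈ Icc (-T n) 0, ξ n t ∈ N)
    (hr : Tendsto (fun n ↦ ξ n (-T n)) atTop (𝓝 r)) {U : Set M} (hU : U ∈ 𝓝 r)
    (hexit : ∀ n, ξ n 0 ∉ U) : Tendsto T atTop atTop := by
  set φ := extChartAt 𝓘(ℝ, E) r with hφ
  obtain ⟨η, hη, hηU⟩ := exists_pos_forall_mem_of_norm_lt (E := E) r hU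
  have hlim : Tendsto (fun n ↦ ‖φ (ξ n (-T n)) - φ r‖) atTop (𝓝 0) := by
    have h1 := (continuousAt_extChartAt (I := 𝓘(ℝ, E)) r).tendsto.comp hr
    have h2 := (h1.sub_const (φ r)).norm
    rwa [sub_self, norm_zero] at h2
  refine tendsto_atTop.2 fun B ↦ ?_
  have hlim' : Tendsto (fun n ↦ ‖φ (ξ n (-T n)) - φ r‖ * Real.exp (K * B)) atTop (𝓝 0) := by
    simpa using hlim.mul_const (Real.exp (K * B))
  filter_upwards [hlim'.eventually_lt_const hη] with n hn
  by_contra! hlt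
  have h1 := norm_orbit_sub_le (fun y hy ↦ h.norm_field_le hy) (neg_nonpos.2 (hT n))
    (fun t ht ↦ h.orbit (hξ n) (hN n t ht))
  refine hexit n (hηU _ (h.subset_source (hN n 0 (right_mem_Icc.2 (neg_nonpos.2 (hT n))))) ?_)
  refine (h1.trans ?_).trans_lt hn
  have hK := h.K_pos
  rw [zero_sub, neg_neg]
  gcongr

lemma IsFlowLine.antitone (hf : ContMDiff 𝓘(ℝ, E) 𝓘(ℝ, ℝ) ∞ f) {γ : ℝ → M}
    (hγ : IsFlowLine (E := E) f γ) : Antitone (f ∘ γ) := by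
  refine antitone_of_hasDerivAt_nonpos (fun t ↦ hγ.hasDerivAt_comp hf t) fun t ↦ ?_
  have := sq_nonneg ‖grad (E := E) f (γ t)‖
  simp only [Pi.zero_apply]
  linarith

/-- In an adapted neighbourhood the square of the distance to `r` in the chart varies along a flow
line by at most a multiple of the drop of `f`. -/
lemma IsAdapted.abs_norm_sq_sub_le (hf : ContMDiff 𝓘(ℝ, E) 𝓘(ℝ, ℝ) ∞ f) {r : M} {N : Set M}
    {δ c K : ℝ} (h : IsAdapted E f r N δ c K) {γ : ℝ → M} (hγ : IsFlowLine (E := E) f γ)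
    {a b : ℝ} (hab : a ≤ b) (hN : ∀ t ∈ Icc a b, γ t ∈ N) :
    |‖extChartAt 𝓘(ℝ, E) r (γ b) - extChartAt 𝓘(ℝ, E) r r‖ ^ 2 -
      ‖extChartAt 𝓘(ℝ, E) r (γ a) - extChartAt 𝓘(ℝ, E) r r‖ ^ 2| ≤
      2 * K / c * (f (γ a) - f (γ b)) := by
  set φ := extChartAt 𝓘(ℝ, E) r with hφ
  set u : ℝ → E := fun t ↦ φ (γ t) - φ r with hu
  have hc := h.c_pos
  have hK := h.K_pos
  have hd : ∀ t ∈ Icc a b, HasDerivAt u (chartField (E := E) f r (φ (γ t))) t := fun t ht ↦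
    (h.orbit hγ (hN t ht)).2.sub_const _
  have hbound : ∀ t ∈ Icc a b, |2 * inner ℝ (u t) (chartField (E := E) f r (φ (γ t)))| ≤
      2 * K / c * ‖grad (E := E) f (γ t)‖ ^ 2 := by
    intro t ht
    have h1 := abs_real_inner_le_norm (u t) (chartField (E := E) f r (φ (γ t)))
    have h2 : ‖chartField (E := E) f r (φ (γ t))‖ ≤ K * ‖u t‖ :=
      h.norm_field_le (h.orbit hγ (hN t ht)).1
    have h3 : c * ‖u t‖ ^ 2 ≤ ‖grad (E := E) f (γ t)‖ ^ 2 := h.le_norm_grad_sq _ (hN t ht)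
    rw [abs_mul, abs_two]
    calc 2 * |inner ℝ (u t) (chartField (E := E) f r (φ (γ t)))|
        ≤ 2 * (‖u t‖ * (K * ‖u t‖)) := by
          refine mul_le_mul_of_nonneg_left (h1.trans ?_) two_pos.le
          gcongr
      _ = 2 * K / c * (c * ‖u t‖ ^ 2) := by field_simp
      _ ≤ 2 * K / c * ‖grad (E := E) f (γ t)‖ ^ 2 := by gcongr
  have hanti : ∀ s : ℝ, |s| = 1 →
      AntitoneOn (fun t ↦ s * ‖u t‖ ^ 2 + 2 * K / c * (f ∘ γ) t) (Icc a b) := by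
    intro s hs
    have hd' : ∀ t ∈ Icc a b, HasDerivAt (fun t ↦ s * ‖u t‖ ^ 2 + 2 * K / c * (f ∘ γ) t)
        (s * (2 * inner ℝ (u t) (chartField (E := E) f r (φ (γ t)))) +
          2 * K / c * (-‖grad (E := E) f (γ t)‖ ^ 2)) t := fun t ht ↦
      ((hd t ht).norm_sq.const_mul s).add ((hγ.hasDerivAt_comp hf t).const_mul _)
    refine antitoneOn_of_hasDerivWithinAt_nonpos (convex_Icc a b)
      (fun t ht ↦ (hd' t ht).continuousAt.continuousWithinAt)
      (fun t ht ↦ (hd' t (interior_subset ht)).hasDerivWithinAt) fun t ht ↦ ?_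
    have h1 := hbound t (interior_subset ht)
    have h2 := le_abs_self (s * (2 * inner ℝ (u t) (chartField (E := E) f r (φ (γ t)))))
    rw [abs_mul, hs, one_mul] at h2
    linarith
  have h1 := hanti 1 (by simp) (left_mem_Icc.2 hab) (right_mem_Icc.2 hab) hab
  have h2 := hanti (-1) (by simp) (left_mem_Icc.2 hab) (right_mem_Icc.2 hab) hab
  simp only [Function.comp_apply] at h1 h2
  rw [abs_le]
  constructor <;> linarith

/-- A flow line that stays in an adapted neighbourhood of `r` for all negative times, with `f`
bounded above, comes from `r`. -/
theorem IsAdapted.tendsto_atBot (hf : ContMDiff 𝓘(ℝ, E) 𝓘(ℝ, ℝ) ∞ f) {r : M} {N : Set M}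
    {δ c K : ℝ} (h : IsAdapted E f r N δ c K) {γ : ℝ → M} (hγ : IsFlowLine (E := E) f γ)
    (hN : ∀ t ≤ 0, γ t ∈ N) {B : ℝ} (hB : ∀ t, f (γ t) ≤ B) : Tendsto γ atBot (𝓝 r) := by
  set φ := extChartAt 𝓘(ℝ, E) r with hφ
  have hc := h.c_pos
  have hK := h.K_pos
  have hlim := tendsto_atBot_ciSup (hγ.antitone hf) ⟨B, by rintro _ ⟨t, rfl⟩; exact hB t⟩
  set m := ⨆ t, (f ∘ γ) t with hm
  have hle : ∀ t, f (γ t) ≤ m := (hγ.antitone hf).ge_of_tendsto hlim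
  refine tendsto_def.2 fun U hU ↦ ?_
  obtain ⟨η, hη, hηU⟩ := exists_pos_forall_mem_of_norm_lt (E := E) r hU
  set ε : ℝ := η ^ 2 / (c⁻¹ + 2 * K / c + 1) with hε
  have hA : 0 < c⁻¹ + 2 * K / c + 1 := by positivity
  have hεpos : 0 < ε := by positivity
  have hεη : (c⁻¹ + 2 * K / c) * ε < η ^ 2 := by
    have : (c⁻¹ + 2 * K / c + 1) * ε = η ^ 2 := mul_div_cancel₀ _ hA.ne'
    linarith
  filter_upwards [hlim.eventually_const_lt (by linarith : m - ε < m), eventually_le_atBot 0]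
    with t ht ht0
  refine hηU _ (h.subset_source (hN t ht0)) ?_
  -- some point of `[t - 1, t]` is close to `r`, because `f` hardly varies on this interval
  obtain ⟨s, hs, hs'⟩ := exists_hasDerivAt_eq_slope (f ∘ γ)
    (fun t ↦ -‖grad (E := E) f (γ t)‖ ^ 2) (by linarith : t - 1 < t)
    (fun s _ ↦ (hγ.hasDerivAt_comp hf s).continuousAt.continuousWithinAt)
    (fun s _ ↦ hγ.hasDerivAt_comp hf s)
  rw [sub_sub_cancel, div_one] at hs'
  simp only [Function.comp_apply] at hs' ht
  have h1 := h.le_norm_grad_sq (γ s) (hN s (hs.2.le.trans ht0))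
  have h2 : ‖φ (γ s) - φ r‖ ^ 2 ≤ c⁻¹ * ε := by
    rw [le_inv_mul_iff₀ hc]
    linarith [hle (t - 1)]
  have h3 := (abs_le.1 (h.abs_norm_sq_sub_le hf hγ hs.2.le
    (fun τ hτ ↦ hN τ (hτ.2.trans ht0)))).2
  have h4 : 2 * K / c * (f (γ s) - f (γ t)) ≤ 2 * K / c * ε := by
    gcongr
    linarith [hle s]
  exact lt_of_pow_lt_pow_left₀ 2 hη.le (by linarith)

/-- A flow line that comes back arbitrarily close to `r` at arbitrarily large times, with `f`
bounded below, converges to `r`: each excursion away from `r` would cost a definite amount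
of `f`. -/
theorem IsAdapted.tendsto_atTop [RegularSpace M] (hf : ContMDiff 𝓘(ℝ, E) 𝓘(ℝ, ℝ) ∞ f) {r : M}
    {N : Set M} {δ c K : ℝ} (h : IsAdapted E f r N δ c K) (hNr : N ∈ 𝓝 r) {γ : ℝ → M}
    (hγ : IsFlowLine (E := E) f γ) {B : ℝ} (hB : ∀ t, B ≤ f (γ t))
    (hr : MapClusterPt r atTop γ) : Tendsto γ atTop (𝓝 r) := by
  set φ := extChartAt 𝓘(ℝ, E) r with hφ
  have hc := h.c_pos
  have hK := h.K_pos
  have hlim := tendsto_atTop_ciInf (hγ.antitone hf) ⟨B, by rintro _ ⟨t, rfl⟩; exact hB t⟩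
  set m := ⨅ t, (f ∘ γ) t with hm
  have hle : ∀ t, m ≤ f (γ t) := (hγ.antitone hf).le_of_tendsto hlim
  refine tendsto_def.2 fun U hU ↦ ?_
  obtain ⟨N', hN', hN'c, hN's⟩ := exists_mem_nhds_isClosed_subset (inter_mem hNr hU)
  obtain ⟨η, hη, hηU⟩ := exists_pos_forall_mem_of_norm_lt (E := E) r (interior_mem_nhds.2 hN')
  have hev1 : ∀ᶠ x in 𝓝 r, ‖φ x - φ r‖ ^ 2 < η ^ 2 / 2 := by
    have h1 : ContinuousAt (fun x ↦ ‖φ x - φ r‖ ^ 2) r :=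
      ((continuousAt_extChartAt r).sub continuousAt_const).norm.pow 2
    refine h1.eventually_lt continuousAt_const ?_
    have h2 : 0 < η ^ 2 / 2 := by positivity
    simpa using h2
  have hev2 : ∀ᶠ t in atTop, 2 * K / c * (f (γ t) - m) < η ^ 2 / 2 := by
    have h1 := (hlim.sub_const m).const_mul (2 * K / c)
    rw [sub_self, mul_zero] at h1
    exact h1.eventually_lt_const (by positivity)
  obtain ⟨t₀, ⟨ht₀, ht₀'⟩, ht₀''⟩ :=
    ((hr.frequently (hev1.and (interior_mem_nhds.2 hN'))).and_eventually hev2).exists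
  filter_upwards [eventually_ge_atTop t₀] with t ht
  by_contra hout
  have hout' : γ t ∉ interior N' := fun h' ↦ hout (hN's (interior_subset h')).2
  obtain ⟨e, he, heN, heU⟩ :=
    exists_first_exit hγ.continuous isOpen_interior hN'c interior_subset ht ht₀' hout'
  refine heU (hηU _ (h.subset_source (hN's (heN e (right_mem_Icc.2 he.1.le))).1) ?_)
  have h3 := (abs_le.1 (h.abs_norm_sq_sub_le hf hγ he.1.le (fun τ hτ ↦ (hN's (heN τ hτ)).1))).2
  have h4 : 2 * K / c * (f (γ t₀) - f (γ e)) ≤ 2 * K / c * (f (γ t₀) - m) := by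
    gcongr
    exact hle e
  exact lt_of_pow_lt_pow_left₀ 2 hη.le (by linarith)

end CriticalPoint

/-! ### Condition (C) and sequences on which the gradient tends to zero -/

section ConditionC

lemma mapClusterPt_of_mem_closure_range {X : Type*} [TopologicalSpace X] [T1Space X] {y : ℕ → X}
    {p : X} (hp : p ∈ closure (range y)) (hne : ∀ n, y n ≠ p) : MapClusterPt p atTop y := by
  refine mapClusterPt_iff_frequently.2 fun U hU ↦ ?_
  by_contra hout
  obtain ⟨k, hk⟩ := eventually_atTop.1 (not_frequently.1 hout)
  have hfin : (y '' Iio k)ᶜ ∈ 𝓝 p := by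
    refine ((finite_Iio k).image y).isClosed.isOpen_compl.mem_nhds ?_
    rintro ⟨n, -, hn⟩
    exact hne n hn
  obtain ⟨_, ⟨hU', hfin'⟩, ⟨n, rfl⟩⟩ := mem_closure_iff_nhds.1 hp _ (inter_mem hU hfin)
  rcases lt_or_ge n k with h | h
  · exact hfin' ⟨n, h, rfl⟩
  · exact hk n h hU'

lemma nhdsNE_neBot_of_chartedSpace {E : Type*} [NormedAddCommGroup E] [NormedSpace ℝ E]
    [Nontrivial E] {M : Type*} [TopologicalSpace M] [ChartedSpace E M] (x : M) :
    (𝓝[≠] x).NeBot := by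
  refine ⟨fun hbot ↦ ?_⟩
  have h1 : 𝓝 x = pure x := by
    rw [← nhdsNE_sup_pure, hbot, bot_sup_eq]
  have h2 := (chartAt E x).map_nhds_eq (mem_chart_source E x)
  rw [h1, Filter.map_pure] at h2
  have h3 : (𝓝[≠] (chartAt E x x)).NeBot := Module.punctured_nhds_neBot ℝ E _
  refine h3.ne ?_
  rw [nhdsWithin, ← h2, ← disjoint_iff, disjoint_principal_right, compl_compl]
  exact mem_pure.2 rfl

variable {E : Type*} [NormedAddCommGroup E] [InnerProductSpace ℝ E] [CompleteSpace E]
  {M : Type*} [EMetricSpace M] [ChartedSpace E M]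
  [RiemannianBundle (fun x : M ↦ TangentSpace 𝓘(ℝ, E) x)]
  [IsManifold 𝓘(ℝ, E) ∞ M]
  [IsContMDiffRiemannianBundle 𝓘(ℝ, E) ∞ E (fun x : M ↦ TangentSpace 𝓘(ℝ, E) x)]
  {f : M → ℝ}

/-- Nondegenerate critical points are isolated, so the regular points are dense. -/
lemma IsMorse.frequently_not_isCritical [Nontrivial E] (hf : IsMorse E f) (x : M) :
    ∃ᶠ y in 𝓝 x, ¬ IsCritical E f y := by
  by_cases hx : IsCritical E f x
  · obtain ⟨N, hN, δ, c, K, h⟩ := exists_isAdapted hf.smooth hx (hf.nondegenerate x hx)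
    have := nhdsNE_neBot_of_chartedSpace (E := E) x
    have h1 : ∀ᶠ y in 𝓝[≠] x, ¬ IsCritical E f y := by
      filter_upwards [self_mem_nhdsWithin, mem_nhdsWithin_of_mem_nhds hN] with y hy hyN hcrit
      exact hy (h.eq_of_isCritical hyN hcrit)
    exact h1.frequently.filter_mono nhdsWithin_le_nhds
  · intro h
    exact absurd hx h.self_of_nhds

/-- The Palais–Smale condition. Since Condition (C) is about sets, the sequence is first moved to
regular points: a critical point in the closure of the range is then a cluster point. -/
theorem IsCFPair.exists_tendsto_subseq [Nontrivial E] (hf : IsCFPair E f) {x : ℕ → M} {C : ℝ}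
    (hC : ∀ n, |f (x n)| ≤ C) (hg : Tendsto (fun n ↦ ‖grad (E := E) f (x n)‖) atTop (𝓝 0)) :
    ∃ (ψ : ℕ → ℕ) (p : M), StrictMono ψ ∧ IsCritical E f p ∧
      Tendsto (fun n ↦ x (ψ n)) atTop (𝓝 p) := by
  have hsm := hf.morse.smooth
  have hex : ∀ n : ℕ, ∃ y, ¬ IsCritical E f y ∧ edist y (x n) < ((n : ENNReal) + 1)⁻¹ ∧
      |f y| < C + 1 ∧ ‖grad (E := E) f y‖ < ‖grad (E := E) f (x n)‖ + 1 / ((n : ℝ) + 1) := by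
    intro n
    have h1 : ∀ᶠ y in 𝓝 (x n), edist y (x n) < ((n : ENNReal) + 1)⁻¹ :=
      Metric.eball_mem_nhds _ (ENNReal.inv_pos.2 (by finiteness))
    have h2 : ∀ᶠ y in 𝓝 (x n), |f y| < C + 1 :=
      hsm.continuous.abs.continuousAt.eventually_lt_const (by linarith [hC n])
    have h3 : ∀ᶠ y in 𝓝 (x n),
        ‖grad (E := E) f y‖ < ‖grad (E := E) f (x n)‖ + 1 / ((n : ℝ) + 1) :=
      (continuous_norm_grad hsm).continuousAt.eventually_lt_const
        (lt_add_of_pos_right _ (by positivity))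
    exact ((hf.morse.frequently_not_isCritical (x n)).and_eventually
      (h1.and (h2.and h3))).exists
  choose y hy hyx hyf hyg using hex
  have hyg0 : Tendsto (fun n ↦ ‖grad (E := E) f (y n)‖) atTop (𝓝 0) := by
    have h1 := hg.add (tendsto_one_div_add_atTop_nhds_zero_nat (𝕜 := ℝ))
    rw [add_zero] at h1
    exact squeeze_zero (fun n ↦ norm_nonneg _) (fun n ↦ (hyg n).le) h1
  obtain ⟨p, hp, hcrit⟩ := hf.conditionC (range y) ⟨C + 1, by rintro _ ⟨n, rfl⟩; exact (hyf n).le⟩ <| by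
    rintro ⟨c, hc, hcy⟩
    obtain ⟨n, hn⟩ := (hyg0.eventually_lt_const hc).exists
    exact absurd (hcy _ ⟨n, rfl⟩) (not_le.2 hn)
  have hclus : MapClusterPt p atTop y :=
    mapClusterPt_of_mem_closure_range hp fun n hn ↦ hy n (hn ▸ hcrit)
  obtain ⟨ψ, hψ, hlim⟩ := hclus.tendsto_subseq
  refine ⟨ψ, p, hψ, hcrit, ?_⟩
  have h0 : Tendsto (fun n : ℕ ↦ edist (y n) (x n)) atTop (𝓝 0) := by
    refine tendsto_of_tendsto_of_tendsto_of_le_of_le tendsto_const_nhds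
      (ENNReal.tendsto_inv_nat_nhds_zero.comp (tendsto_add_atTop_nat 1)) (fun _ ↦ zero_le)
      fun n ↦ ?_
    have := (hyx n).le
    simpa using this
  rw [tendsto_iff_edist_tendsto_0] at hlim ⊢
  have h1 := (h0.comp hψ.tendsto_atTop).add hlim
  rw [add_zero] at h1
  refine tendsto_of_tendsto_of_tendsto_of_le_of_le tendsto_const_nhds h1 (fun _ ↦ zero_le)
    fun n ↦ ?_
  have h2 := edist_triangle (x (ψ n)) (y (ψ n)) p
  rwa [edist_comm (x (ψ n)) (y (ψ n))] at h2

/-- By the Palais–Smale condition, infinitely many critical points on which `f` is bounded would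
accumulate at a critical point, which is isolated. -/
theorem IsCFPair.finite_isCritical [Nontrivial E] (hf : IsCFPair E f) (a b : ℝ) :
    {r : M | IsCritical E f r ∧ f r ∈ Icc a b}.Finite := by
  by_contra hinf
  have hinf : {r : M | IsCritical E f r ∧ f r ∈ Icc a b}.Infinite := hinf
  set x := hinf.natEmbedding with hx
  have h0 : Tendsto (fun n ↦ ‖grad (E := E) f (x n : M)‖) atTop (𝓝 0) := by
    refine tendsto_const_nhds.congr fun n ↦ ?_
    rw [(grad_eq_zero_iff f _).2 (x n).2.1]
    exact norm_zero.symm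
  obtain ⟨ψ, p, hψ, hp, hlim⟩ := hf.exists_tendsto_subseq (x := fun n ↦ (x n : M))
    (C := max |a| |b|) (fun n ↦ abs_le_max_abs_abs (x n).2.2.1 (x n).2.2.2) h0
  obtain ⟨N, hN, δ, c, K, h⟩ := exists_isAdapted hf.morse.smooth hp (hf.morse.nondegenerate p hp)
  obtain ⟨k, hk⟩ := eventually_atTop.1 (hlim hN)
  have h1 : ∀ n ≥ k, (x (ψ n) : M) = p := fun n hn ↦ h.eq_of_isCritical (hk n hn) (x (ψ n)).2.1
  have h2 : ψ k = ψ (k + 1) :=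
    x.injective (Subtype.ext ((h1 k le_rfl).trans (h1 (k + 1) k.le_succ).symm))
  exact absurd h2 (hψ k.lt_succ_self).ne

end ConditionC

/-! ### The limit of a flow line, and the next critical point -/

section NextCriticalPoint

variable {E : Type*} [NormedAddCommGroup E] [InnerProductSpace ℝ E] [CompleteSpace E]
  {M : Type*} [EMetricSpace M] [ChartedSpace E M]
  [RiemannianBundle (fun x : M ↦ TangentSpace 𝓘(ℝ, E) x)]
  [IsManifold 𝓘(ℝ, E) ∞ M]
  [IsContMDiffRiemannianBundle 𝓘(ℝ, E) ∞ E (fun x : M ↦ TangentSpace 𝓘(ℝ, E) x)]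
  {f : M → ℝ}

/-- A flow line on which `f` is bounded below tends to a critical point: by the mean value theorem
the gradient tends to zero along a sequence of times, and this sequence has a critical cluster
point. -/
theorem IsCFPair.exists_tendsto_atTop [Nontrivial E] (hf : IsCFPair E f) {γ : ℝ → M}
    (hγ : IsFlowLine (E := E) f γ) {a b : ℝ} (hab : ∀ t, f (γ t) ∈ Icc a b) :
    ∃ r, IsCritical E f r ∧ Tendsto γ atTop (𝓝 r) := by
  have hsm := hf.morse.smooth
  have hlim := tendsto_atTop_ciInf (hγ.antitone hsm) ⟨a, by rintro _ ⟨t, rfl⟩; exact (hab t).1⟩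
  have hmvt : ∀ n : ℕ, ∃ t ∈ Ioo (n : ℝ) (n + 1),
      ‖grad (E := E) f (γ t)‖ ^ 2 = f (γ n) - f (γ (n + 1)) := by
    intro n
    have hcont : Continuous (f ∘ γ) := hsm.continuous.comp hγ.continuous
    obtain ⟨t, ht, heq⟩ := exists_hasDerivAt_eq_slope (f ∘ γ) _ (lt_add_one (n : ℝ))
      hcont.continuousOn fun t _ ↦ hγ.hasDerivAt_comp hsm t
    refine ⟨t, ht, ?_⟩
    rw [add_sub_cancel_left, div_one] at heq
    simp only [Function.comp_apply] at heq
    linarith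
  choose t ht hgt using hmvt
  have ht' : Tendsto t atTop atTop :=
    tendsto_atTop_mono (fun n ↦ (ht n).1.le) tendsto_natCast_atTop_atTop
  have hg : Tendsto (fun n ↦ ‖grad (E := E) f (γ (t n))‖) atTop (𝓝 0) := by
    have h1 := (hlim.comp (tendsto_natCast_atTop_atTop (R := ℝ))).sub
      (hlim.comp (tendsto_atTop_add_const_right _ 1 (tendsto_natCast_atTop_atTop (R := ℝ))))
    rw [sub_self] at h1
    have h2 := h1.sqrt
    rw [Real.sqrt_zero] at h2
    refine h2.congr fun n ↦ ?_
    simp only [Function.comp_apply]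
    rw [← hgt n, Real.sqrt_sq (norm_nonneg _)]
  obtain ⟨ψ, r, hψ, hr, hlimr⟩ := hf.exists_tendsto_subseq (x := fun n ↦ γ (t n))
    (fun n ↦ abs_le_max_abs_abs (hab _).1 (hab _).2) hg
  obtain ⟨N, hN, δ, c, K, h⟩ := exists_isAdapted hsm hr (hf.morse.nondegenerate r hr)
  refine ⟨r, hr, h.tendsto_atTop hsm hN hγ (fun t ↦ (hab t).1) ?_⟩
  exact (hlimr.mapClusterPt).of_comp (φ := fun n ↦ t (ψ n)) (ht'.comp hψ.tendsto_atTop)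

/-- If points of flow lines tend to a critical point `r` that is not the forward limit of these
flow lines, then, after passing to a subsequence, the points at which the flow lines next leave a
neighbourhood of `r` tend to a point of a flow line `γ'` issuing from `r`, and later points tend
to the forward limit of `γ'`. -/
theorem IsCFPair.exists_next [Nontrivial E] [IsRiemannianManifold 𝓘(ℝ, E) M] [CompleteSpace M]
    (hf : IsCFPair E f) {ξ : ℕ → ℝ → M}
    (hξ : ∀ k, IsFlowLine (E := E) f (ξ k)) {a b : ℝ} (hab : ∀ k t, f (ξ k t) ∈ Icc a b) {q r : M}
    (hq : ∀ k, Tendsto (ξ k) atTop (𝓝 q)) (hr : IsCritical E f r) (hrq : r ≠ q) {σ : ℕ → ℝ}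
    (hσ : Tendsto (fun k ↦ ξ k (σ k)) atTop (𝓝 r)) :
    ∃ (m : ℕ → ℕ) (e σ' : ℕ → ℝ) (γ' : ℝ → M) (r' : M), StrictMono m ∧
      (∀ k, σ (m k) < e k ∧ e k ≤ σ' k) ∧ IsFlowLine (E := E) f γ' ∧
      Tendsto γ' atBot (𝓝 r) ∧ Tendsto γ' atTop (𝓝 r') ∧ IsCritical E f r' ∧ f r' < f r ∧
      Tendsto (fun k ↦ ξ (m k) (e k)) atTop (𝓝 (γ' 0)) ∧
      Tendsto (fun k ↦ ξ (m k) (σ' k)) atTop (𝓝 r') := by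
  have hsm := hf.morse.smooth
  have hbij := hf.morse.nondegenerate r hr
  obtain ⟨N₀, hN₀, δ, c, K, h₀⟩ := exists_isAdapted hsm hr hbij
  obtain ⟨N, hN, hNc, hNs⟩ :=
    exists_mem_nhds_isClosed_subset (inter_mem hN₀ (isOpen_ne.mem_nhds hrq))
  have h := h₀.mono fun x hx ↦ (hNs hx).1
  have hqN : q ∉ N := fun hq' ↦ (hNs hq').2 rfl
  obtain ⟨k₀, hk₀⟩ := eventually_atTop.1 (hσ (interior_mem_nhds.2 hN))
  have hexit : ∀ k, ∃ e, σ (k + k₀) < e ∧ (∀ t ∈ Icc (σ (k + k₀)) e, ξ (k + k₀) t ∈ N) ∧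
      ξ (k + k₀) e ∉ interior N := by
    intro k
    obtain ⟨t, ht, htN⟩ := ((eventually_ge_atTop (σ (k + k₀))).and
      (hq (k + k₀) (hNc.isOpen_compl.mem_nhds hqN))).exists
    obtain ⟨e, he, heN, heU⟩ := exists_first_exit (hξ (k + k₀)).continuous isOpen_interior hNc
      interior_subset ht (hk₀ _ (k₀.le_add_left k)) fun h' ↦ htN (interior_subset h')
    exact ⟨e, he.1, heN, heU⟩
  choose e heσ heN heU using hexit
  -- restart the flow lines at their exit from `N`; they have then spent the time `T k` in `N`
  set T : ℕ → ℝ := fun k ↦ e k - σ (k + k₀) with hT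
  set ζ : ℕ → ℝ → M := fun k t ↦ ξ (k + k₀) (t + e k) with hζ
  have hζf : ∀ k, IsFlowLine (E := E) f (ζ k) := fun k ↦ (hξ (k + k₀)).comp_add (e k)
  have hζT : ∀ k, ζ k (-T k) = ξ (k + k₀) (σ (k + k₀)) := by
    intro k
    simp only [hζ, hT]
    congr 1
    ring
  have hζ0 : ∀ k, ζ k 0 = ξ (k + k₀) (e k) := by
    intro k
    simp only [hζ, zero_add]
  have hζN : ∀ k, ∀ t ∈ Icc (-T k) 0, ζ k t ∈ N := by
    intro k t ht
    refine heN k _ ⟨?_, ?_⟩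
    · have := ht.1
      simp only [hT] at this
      linarith
    · linarith [ht.2]
  have hζr : Tendsto (fun k ↦ ζ k (-T k)) atTop (𝓝 r) := by
    simp_rw [hζT]
    exact hσ.comp (tendsto_add_atTop_nat k₀)
  have hζU : ∀ k, ζ k 0 ∉ interior N := fun k ↦ by rw [hζ0]; exact heU k
  have hTtop : Tendsto T atTop atTop :=
    h.tendsto_exit_time hζf (fun k ↦ sub_nonneg.2 (heσ k).le) hζN hζr
      (interior_mem_nhds.2 hN) hζU
  have hev : ∀ S : ℝ, ∀ᶠ k in atTop, ∀ t ∈ Icc (-S) 0, t ∈ Icc (-T k) 0 := by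
    intro S
    filter_upwards [hTtop.eventually_ge_atTop S] with k hk t ht
    exact ⟨(neg_le_neg hk).trans ht.1, ht.2⟩
  obtain ⟨ψ, w, hψ, hw⟩ := h.exists_tendsto_subseq hbij (hf.finite_index r hr) hζf
    (fun k ↦ hζN k 0 ⟨neg_nonpos.2 (sub_nonneg.2 (heσ k).le), le_rfl⟩)
    fun S ↦ (hev S).mono fun k hk t ht ↦ hζN k t (hk t ht)
  obtain ⟨γ', hγ', hlim⟩ := exists_limit_flowLine hsm (fun k ↦ hζf (ψ k))
    (fun k t ↦ hab (ψ k + k₀) _) hw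
  have hγN : ∀ t ≤ 0, γ' t ∈ N := by
    intro t ht
    refine hNc.mem_of_tendsto (hlim t) ?_
    filter_upwards [hψ.tendsto_atTop.eventually (hev (-t))] with k hk
    exact hζN _ t (hk t ⟨(neg_neg t).le, ht⟩)
  have hγU : γ' 0 ∉ interior N :=
    isOpen_interior.isClosed_compl.mem_of_tendsto (hlim 0) (Eventually.of_forall fun k ↦ hζU _)
  have hflim : ∀ t, Tendsto (fun k ↦ f (ζ (ψ k) t)) atTop (𝓝 (f (γ' t))) :=
    fun t ↦ (hsm.continuous.tendsto _).comp (hlim t)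
  have hγab : ∀ t, f (γ' t) ∈ Icc a b :=
    fun t ↦ isClosed_Icc.mem_of_tendsto (hflim t) (Eventually.of_forall fun k ↦ hab _ _)
  have hγr : ∀ t, f (γ' t) ≤ f r := by
    intro t
    refine le_of_tendsto_of_tendsto (hflim t)
      (((hsm.continuous.tendsto r).comp hζr).comp hψ.tendsto_atTop) ?_
    filter_upwards [(hTtop.comp hψ.tendsto_atTop).eventually_ge_atTop (-t)] with k hk
    exact (hζf (ψ k)).antitone hsm (neg_le.1 hk)
  obtain ⟨r', hr', htop⟩ := hf.exists_tendsto_atTop hγ' hγab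
  have hr'le : ∀ t, f r' ≤ f (γ' t) :=
    (hγ'.antitone hsm).le_of_tendsto ((hsm.continuous.tendsto r').comp htop)
  -- otherwise `f` is constant on `γ'`, and `γ' 0` is a critical point of `N` other than `r`
  have hlt : f r' < f r := by
    by_contra hle
    have hconst : f ∘ γ' = fun _ ↦ f r :=
      funext fun t ↦ le_antisymm (hγr t) ((not_lt.1 hle).trans (hr'le t))
    have h1 := hγ'.hasDerivAt_comp hsm 0
    rw [hconst] at h1
    have h2 := h1.unique (hasDerivAt_const 0 (f r))
    have h3 : ‖grad (E := E) f (γ' 0)‖ = 0 := by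
      rw [neg_eq_zero] at h2
      exact pow_eq_zero_iff two_ne_zero |>.1 h2
    have h4 := h.eq_of_isCritical (hγN 0 le_rfl) ((grad_eq_zero_iff f _).1 (norm_eq_zero.1 h3))
    exact hγU (h4 ▸ mem_interior_iff_mem_nhds.2 hN)
  -- a diagonal choice: at time `j` the `j`-th chosen flow line is close to `γ' j`
  obtain ⟨φ, hφ, hφd⟩ := extraction_forall_of_eventually' (P := fun (j : ℕ) (k : ℕ) ↦
    edist (ζ (ψ k) j) (γ' j) < ((j : ENNReal) + 1)⁻¹) fun j ↦
      eventually_atTop.1 <| (hlim j).eventually (Metric.eball_mem_nhds _ (ENNReal.inv_pos.2 (by finiteness)))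
  refine ⟨fun j ↦ ψ (φ j) + k₀, fun j ↦ e (ψ (φ j)), fun j ↦ j + e (ψ (φ j)), γ', r',
    fun i j hij ↦ Nat.add_lt_add_right (hψ (hφ hij)) k₀, fun j ↦ ⟨heσ _, ?_⟩, hγ',
    h.tendsto_atBot hsm hγ' hγN hγr, htop, hr', hlt, ?_, ?_⟩
  · exact le_add_of_nonneg_left j.cast_nonneg
  · exact ((hlim 0).comp hφ.tendsto_atTop).congr fun j ↦ hζ0 _
  · have h0 : Tendsto (fun j : ℕ ↦ edist (ζ (ψ (φ j)) j) (γ' j)) atTop (𝓝 0) := by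
      refine tendsto_of_tendsto_of_tendsto_of_le_of_le tendsto_const_nhds
        (ENNReal.tendsto_inv_nat_nhds_zero.comp (tendsto_add_atTop_nat 1)) (fun _ ↦ zero_le)
        fun j ↦ ?_
      have := (hφd j).le
      simpa using this
    have h1 := tendsto_iff_edist_tendsto_0.1 (htop.comp (tendsto_natCast_atTop_atTop (R := ℝ)))
    have h2 := h0.add h1
    rw [add_zero] at h2
    rw [tendsto_iff_edist_tendsto_0]
    exact tendsto_of_tendsto_of_tendsto_of_le_of_le tendsto_const_nhds h2 (fun _ ↦ zero_le)
      fun j ↦ edist_triangle _ _ _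

end NextCriticalPoint

/-! ### The chain of critical points -/

section Chain

/-- On a manifold modelled on the zero space every curve is constant. -/
lemma nontrivial_of_tendsto_ne {E : Type*} [NormedAddCommGroup E] {M : Type*}
    [TopologicalSpace M] [T2Space M] [ChartedSpace E M] {γ : ℝ → M} (hγ : Continuous γ) {p q : M}
    (hpq : p ≠ q) (hp : Tendsto γ atBot (𝓝 p)) (hq : Tendsto γ atTop (𝓝 q)) : Nontrivial E := by
  by_contra hE
  rw [not_nontrivial_iff_subsingleton] at hE
  have : DiscreteTopology M := ChartedSpace.discreteTopology E M
  have hconst : ∀ t, γ t = γ 0 := fun t ↦ PreconnectedSpace.constant inferInstance hγ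
  have hγ' : γ = fun _ ↦ γ 0 := funext hconst
  rw [hγ'] at hp hq
  exact hpq ((tendsto_nhds_unique tendsto_const_nhds hp).symm.trans
    (tendsto_nhds_unique tendsto_const_nhds hq))

variable {E : Type*} [NormedAddCommGroup E] [InnerProductSpace ℝ E] [CompleteSpace E]
  {M : Type*} [EMetricSpace M] [ChartedSpace E M]
  [RiemannianBundle (fun x : M ↦ TangentSpace 𝓘(ℝ, E) x)]
  [IsManifold 𝓘(ℝ, E) ∞ M]
  [IsContMDiffRiemannianBundle 𝓘(ℝ, E) ∞ E (fun x : M ↦ TangentSpace 𝓘(ℝ, E) x)]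
  {f : M → ℝ}

/-- If points of flow lines that end at `q` tend to a critical point `r`, then a subsequence of
these flow lines converges, from there on, to a chain of flow lines from `r` to `q`. The proof is
by induction on the number of critical points below `r`. -/
theorem IsCFPair.exists_chain [Nontrivial E] [IsRiemannianManifold 𝓘(ℝ, E) M] [CompleteSpace M]
    (hf : IsCFPair E f) {a b : ℝ} {q : M} {ξ : ℕ → ℝ → M}
    (hξ : ∀ k, IsFlowLine (E := E) f (ξ k)) (hab : ∀ k t, f (ξ k t) ∈ Icc a b)
    (hq : ∀ k, Tendsto (ξ k) atTop (𝓝 q)) {r : M} (hr : IsCritical E f r) {σ : ℕ → ℝ}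
    (hσ : Tendsto (fun k ↦ ξ k (σ k)) atTop (𝓝 r)) :
    ∃ (L : ℕ) (ρ : Fin (L + 1) → M) (g : Fin L → ℝ → M) (n : ℕ → ℕ) (s : ℕ → Fin L → ℝ),
      ρ 0 = r ∧ ρ (Fin.last L) = q ∧ (∀ i, IsCritical E f (ρ i)) ∧ StrictAnti (f ∘ ρ) ∧
      (∀ i, IsFlowLine (E := E) f (g i) ∧ Tendsto (g i) atBot (𝓝 (ρ i.castSucc)) ∧
        Tendsto (g i) atTop (𝓝 (ρ i.succ))) ∧
      StrictMono n ∧ (∀ k, StrictMono (s k)) ∧ (∀ k i, σ (n k) < s k i) ∧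
      ∀ i, Tendsto (fun k ↦ ξ (n k) (s k i)) atTop (𝓝 (g i 0)) := by
  have hsm := hf.morse.smooth
  induction hcard : {x : M | (IsCritical E f x ∧ f x ∈ Icc a b) ∧ f x < f r}.ncard
    using Nat.strong_induction_on generalizing r ξ σ with
  | _ d ih =>
  by_cases hrq : r = q
  · exact ⟨0, fun _ ↦ r, Fin.elim0, id, fun _ ↦ Fin.elim0, rfl, hrq, fun _ ↦ hr,
      fun i j hij ↦ absurd hij (by lia), fun i ↦ i.elim0, strictMono_id, fun _ ↦ Subsingleton.strictMono _,
      fun _ i ↦ i.elim0, fun i ↦ i.elim0⟩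
  obtain ⟨m, e, σ', γ', r', hm, hσe, hγ', hbot, htop, hr', hlt, he, hσ'⟩ :=
    hf.exists_next hξ hab hq hr hrq hσ
  have hr'ab : f r' ∈ Icc a b := isClosed_Icc.mem_of_tendsto ((hsm.continuous.tendsto r').comp hσ')
    (Eventually.of_forall fun k ↦ hab _ _)
  have hfin : {x : M | (IsCritical E f x ∧ f x ∈ Icc a b) ∧ f x < f r}.Finite :=
    (hf.finite_isCritical a b).subset fun x hx ↦ hx.1
  have hsub : {x : M | (IsCritical E f x ∧ f x ∈ Icc a b) ∧ f x < f r'} ⊂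
      {x : M | (IsCritical E f x ∧ f x ∈ Icc a b) ∧ f x < f r} :=
    ⟨fun x hx ↦ ⟨hx.1, hx.2.trans hlt⟩, fun hle ↦ lt_irrefl _ (hle ⟨⟨hr', hr'ab⟩, hlt⟩).2⟩
  obtain ⟨L, ρ, g, n, s, hρ0, hρq, hρ, hanti, hg, hn, hs, hσs, hlim⟩ :=
    ih _ (hcard ▸ ncard_lt_ncard hsub hfin) (fun k ↦ hξ (m k)) (fun k ↦ hab (m k))
      (fun k ↦ hq (m k)) hr' hσ' rfl
  refine ⟨L + 1, Fin.cons r ρ, Fin.cons γ' g, m ∘ n, fun k ↦ Fin.cons (e (n k)) (s k),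
    rfl, ?_, ?_, ?_, ?_, hm.comp hn, fun k ↦ ?_, fun k ↦ ?_, ?_⟩
  · rw [← Fin.succ_last, Fin.cons_succ, hρq]
  · exact Fin.cases hr hρ
  · refine Fin.strictAnti_iff_succ_lt.2 (Fin.cases ?_ fun i ↦ ?_)
    · simpa [hρ0] using hlt
    · exact hanti i.castSucc_lt_succ
  · refine Fin.cases ⟨hγ', hbot, ?_⟩ fun i ↦ hg i
    simpa [hρ0] using htop
  · intro i j hij
    induction j using Fin.cases with
    | zero => exact absurd hij (Fin.not_lt_zero i)
    | succ j =>
      induction i using Fin.cases with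
      | zero => exact (hσe (n k)).2.trans_lt (hσs k j)
      | succ i => exact hs k (Fin.succ_lt_succ_iff.1 hij)
  · refine Fin.cases (hσe (n k)).1 fun i ↦ ?_
    exact ((hσe (n k)).1.trans_le (hσe (n k)).2).trans (hσs k i)
  · exact Fin.cases (he.comp hn.tendsto_atTop) hlim

end Chain

end HilbertMorse

theorem theorem3p1
    {E : Type*} [NormedAddCommGroup E] [InnerProductSpace ℝ E] [CompleteSpace E]
    {M : Type*} [EMetricSpace M] [ChartedSpace E M] [IsManifold 𝓘(ℝ, E) ∞ M]
    [RiemannianBundle (fun x : M ↦ TangentSpace 𝓘(ℝ, E) x)]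
    [IsContMDiffRiemannianBundle 𝓘(ℝ, E) ∞ E (fun x : M ↦ TangentSpace 𝓘(ℝ, E) x)]
    [IsRiemannianManifold 𝓘(ℝ, E) M] [CompleteSpace M]
    (f : M → ℝ) (hf : HilbertMorse.IsCFPair E f)
    (p q : M) (hp : HilbertMorse.IsCritical E f p) (hq : HilbertMorse.IsCritical E f q)
    (hpq : p ≠ q)
    (γ : ℕ → ℝ → M) (hγ : ∀ n, HilbertMorse.IsFlowLine (E := E) f (γ n))
    (hγp : ∀ n, Tendsto (γ n) atBot (𝓝 p)) (hγq : ∀ n, Tendsto (γ n) atTop (𝓝 q)) :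
    ∃ (l : ℕ) (r : Fin (l + 2) → M) (γ' : Fin (l + 1) → ℝ → M),
      Function.Injective r ∧ (∀ i, HilbertMorse.IsCritical E f (r i)) ∧
      r 0 = p ∧ r (Fin.last (l + 1)) = q ∧
      (∀ i, HilbertMorse.IsFlowLine (E := E) f (γ' i) ∧
        Tendsto (γ' i) atBot (𝓝 (r i.castSucc)) ∧ Tendsto (γ' i) atTop (𝓝 (r i.succ))) ∧
      ∃ (n : ℕ → ℕ) (s : ℕ → Fin (l + 1) → ℝ),
        StrictMono n ∧ (∀ k, StrictMono (s k)) ∧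
        ∀ i, Tendsto (fun k ↦ γ (n k) (s k i)) atTop (𝓝 (γ' i 0)) := by
  have hsm := hf.morse.smooth
  have : Nontrivial E :=
    HilbertMorse.nontrivial_of_tendsto_ne (hγ 0).continuous hpq (hγp 0) (hγq 0)
  have hab : ∀ n t, f (γ n t) ∈ Icc (f q) (f p) := fun n t ↦
    ⟨((hγ n).antitone hsm).le_of_tendsto ((hsm.continuous.tendsto q).comp (hγq n)) t,
      ((hγ n).antitone hsm).ge_of_tendsto ((hsm.continuous.tendsto p).comp (hγp n)) t⟩
  have hσ : ∀ n : ℕ, ∃ t, edist (γ n t) p < ((n : ENNReal) + 1)⁻¹ := fun n ↦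
    ((hγp n).eventually (Metric.eball_mem_nhds _ (ENNReal.inv_pos.2 (by finiteness)))).exists
  choose σ hσ using hσ
  have hσp : Tendsto (fun n ↦ γ n (σ n)) atTop (𝓝 p) := by
    rw [tendsto_iff_edist_tendsto_0]
    refine tendsto_of_tendsto_of_tendsto_of_le_of_le tendsto_const_nhds
      (ENNReal.tendsto_inv_nat_nhds_zero.comp (tendsto_add_atTop_nat 1)) (fun _ ↦ zero_le)
      fun n ↦ ?_
    have := (hσ n).le
    simpa using this
  obtain ⟨L, r, γ', n, s, hr0, hrq, hr, hanti, hγ', hn, hs, -, hlim⟩ :=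
    hf.exists_chain hγ hab hγq hp hσp
  obtain _ | l := L
  -- a chain without flow lines would give `p = q`
  · exact absurd (hr0.symm.trans hrq) hpq
  · exact ⟨l, r, γ', hanti.injective.of_comp, hr, hr0, hrq, hγ', n, s, hn, hs, hlim⟩
end
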